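/- Let $\mathbb{F}\in\{\mathbb{R},\mathbb{C},\mathbb{H}\}$ and $m=\dim_{\mathbb{R}}\mathbb{F}\in\{1,2,4\}$. Equip the space $M(4,\mathbb{F})$ of $4\times 4$ matrices with the Euclidean inner product $\langle A,B\rangle=\operatorname{Re}\operatorname{tr}(AB^*)$, let $E(4,\mathbb{F})=\{A\in M(4,\mathbb{F}): A^*=A,\ \operatorname{tr}A=0\}$, and let $S(4,\mathbb{F})$ be the unit sphere of $E(4,\mathbb{F})$. Let $f_3:S(4,\mathbb{F})\to\mathbb{R}$, $f_3(A)=\operatorname{tr}A^3$, and let $\mathcal{B}_{4,\mathbb{F}}$ and $\mathcal{C}_{4,\mathbb{F}}$ be the sets of regular points and of critical points of $f_3$ in $f_3^{-1}(0)$, respectively. Then $\mathcal{B}_{4,\mathbb{F}}$ is a smooth embedded submanifold of dimension $6m+1$ (a hypersurface of $S(4,\mathbb{F})$), and the scalar curvature (the trace of the Ricci tensor) at $A\in\mathcal{B}_{4,\mathbb{F}}$ of the Riemannian metric induced on it by $\langle\cdot,\cdot\rangle$ is $$s(A)=6m(6m+1)-2m\left(\operatorname{tr}A^4-\frac14\right)^{-1}.$$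 In particular, $s(A)\to-\infty$ as $A\in\mathcal{B}_{4,\mathbb{F}}$ and $\operatorname{tr}A^4\to\frac14$, and $s(A)\to-\infty$ as $A\in\mathcal{B}_{4,\mathbb{F}}$ approaches the set $\mathcal{C}_{4,\mathbb{F}}$: for every $K\in\mathbb{R}$ there is a neighbourhood $W$ of $\mathcal{C}_{4,\mathbb{F}}$ in $M(4,\mathbb{F})$ such that $s(A)\le K$ for all $A\in\mathcal{B}_{4,\mathbb{F}}\cap W$. -/

import Mathlib

open Filter Topology
open scoped Matrix Matrix.Norms.Frobenius Quaternion ContDiff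

noncomputable section

/-! ### Scalar curvature of a smooth submanifold of a Euclidean space -/

section Curvature

/-- The partial derivative `∂ᵢ f` at `u` of a function of `d` real variables. -/
def coordDeriv {d : ℕ} {E : Type*} [NormedAddCommGroup E] [NormedSpace ℝ E]
    (i : Fin d) (f : (Fin d → ℝ) → E) (u : Fin d → ℝ) : E :=
  fderiv ℝ f u (Pi.single i 1)

/-- The first fundamental form `g i j = ⟪∂ᵢ φ, ∂ⱼ φ⟫` of a parametrization `φ`. -/
def firstFundamentalForm {d : ℕ} {E : Type*} [NormedAddCommGroup E] [InnerProductSpace ℝ E]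
    (φ : (Fin d → ℝ) → E) (u : Fin d → ℝ) : Matrix (Fin d) (Fin d) ℝ :=
  Matrix.of fun i j => inner ℝ (coordDeriv i φ u) (coordDeriv j φ u)

/-- The Christoffel symbol `Γᵏᵢⱼ` of the Levi-Civita connection of the metric `g`. -/
def christoffel {d : ℕ} (g : (Fin d → ℝ) → Matrix (Fin d) (Fin d) ℝ)
    (k i j : Fin d) (u : Fin d → ℝ) : ℝ :=
  (1 / 2) * ∑ l, (g u)⁻¹ k l *
    (coordDeriv i (fun v => g v j l) u + coordDeriv j (fun v => g v i l) u
      - coordDeriv l (fun v => g v i j) u)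

/-- The `l`-th component of `R(∂ᵢ, ∂ⱼ) ∂ₖ`, where
`R(X, Y) = ∇_X ∇_Y - ∇_Y ∇_X - ∇_[X, Y]` for the Levi-Civita connection of `g`. -/
def riemannTensor {d : ℕ} (g : (Fin d → ℝ) → Matrix (Fin d) (Fin d) ℝ)
    (l k i j : Fin d) (u : Fin d → ℝ) : ℝ :=
  coordDeriv i (christoffel g l j k) u - coordDeriv j (christoffel g l i k) u
    + ∑ r, (christoffel g l i r u * christoffel g r j k u
      - christoffel g l j r u * christoffel g r i k u)

/-- The Ricci tensor `Ric(∂ⱼ, ∂ₖ)`, the trace of `X ↦ R(X, ∂ⱼ) ∂ₖ`. -/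
def ricciTensor {d : ℕ} (g : (Fin d → ℝ) → Matrix (Fin d) (Fin d) ℝ)
    (j k : Fin d) (u : Fin d → ℝ) : ℝ :=
  ∑ i, riemannTensor g i k i j u

/-- The scalar curvature of the metric `g` on an open subset of `ℝᵈ`: the `g`-trace of the
Ricci tensor (without normalization). -/
def metricScalarCurvature {d : ℕ} (g : (Fin d → ℝ) → Matrix (Fin d) (Fin d) ℝ)
    (u : Fin d → ℝ) : ℝ :=
  ∑ j, ∑ k, (g u)⁻¹ j k * ricciTensor g j k u

/-- `φ : U → M` is a smooth local parametrization of the subset `M` of `E` by `d` parameters: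
`U` is open, `φ` is a smooth immersion on `U`, and `φ` maps `U` homeomorphically onto a relatively
open subset of `M`. -/
structure IsLocalParametrization {d : ℕ} {E : Type*} [NormedAddCommGroup E]
    [InnerProductSpace ℝ E] (M : Set E) (U : Set (Fin d → ℝ)) (φ : (Fin d → ℝ) → E) : Prop where
  isOpen_source : IsOpen U
  contDiffOn : ContDiffOn ℝ ∞ φ U
  immersion : ∀ u ∈ U, Function.Injective (fderiv ℝ φ u)
  isEmbedding : Topology.IsEmbedding (fun u : U => φ u)
  image_eq : ∃ V : Set E, IsOpen V ∧ φ '' U = M ∩ V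

/-- Near its point `p` the set `M` is a smooth embedded `d`-dimensional submanifold of `E`, and the
scalar curvature at `p` of the Riemannian metric that `E` induces on `M` is `s`: there is a local
parametrization of `M` around `p`, and the scalar curvature, computed in any of them, is `s`. -/
def HasScalarCurvatureAt {E : Type*} [NormedAddCommGroup E] [InnerProductSpace ℝ E]
    (M : Set E) (d : ℕ) (p : E) (s : ℝ) : Prop :=
  (∃ (U : Set (Fin d → ℝ)) (φ : (Fin d → ℝ) → E),
    IsLocalParametrization M U φ ∧ ∃ u ∈ U, φ u = p) ∧
  ∀ (U : Set (Fin d → ℝ)) (φ : (Fin d → ℝ) → E), IsLocalParametrization M U φ →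
    ∀ u ∈ U, φ u = p → metricScalarCurvature (firstFundamentalForm φ) u = s

end Curvature

/-! ### Hermitian matrices over `ℝ`, `ℂ`, `ℍ` -/

section Matrices

/-- The real part of a real, complex or quaternionic number. -/
def rePart {F : Type*} [NormedRing F] [InnerProductSpace ℝ F] (x : F) : ℝ :=
  inner ℝ (1 : F) x

theorem rePart_real (x : ℝ) : rePart x = x := by simp [rePart]

theorem rePart_complex (z : ℂ) : rePart z = z.re := by simp [rePart, Complex.inner]

theorem rePart_quaternion (q : ℍ[ℝ]) : rePart q = q.re := by
  simp [rePart, Quaternion.inner_def]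

/-- The Euclidean inner product on `M(n, F)`; its norm is the Frobenius norm. By the three lemmas
that follow, it is `⟪A, B⟫ = Re tr (A Bᴴ)` over `ℝ`, `ℂ` and `ℍ`. -/
instance matrixInnerProductSpace {n : ℕ} {F : Type*} [NormedRing F] [InnerProductSpace ℝ F] :
    InnerProductSpace ℝ (Matrix (Fin n) (Fin n) F) :=
  { (Matrix.frobeniusNormedSpace : NormedSpace ℝ (Matrix (Fin n) (Fin n) F)) with
    inner := fun A B => ∑ i, ∑ j, inner ℝ (A i j) (B i j)
    norm_sq_eq_re_inner := fun A => by
      rw [Matrix.frobenius_norm_def, ← Real.sqrt_eq_rpow, Real.sq_sqrt (by positivity)]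
      simp
    conj_inner_symm := fun A B => by
      simp [real_inner_comm]
    add_left := fun A B C => by
      simp [inner_add_left, Finset.sum_add_distrib]
    smul_left := fun A B r => by
      simp [real_inner_smul_left, Finset.mul_sum] }

theorem matrix_inner_real {n : ℕ} (A B : Matrix (Fin n) (Fin n) ℝ) :
    inner ℝ A B = rePart (A * Bᴴ).trace := by
  rw [rePart_real, Matrix.trace]
  simp only [Matrix.diag_apply, Matrix.mul_apply, Matrix.conjTranspose_apply]
  change (∑ i, ∑ j, inner ℝ (A i j) (B i j)) = _
  simp [mul_comm]

theorem matrix_inner_complex {n : ℕ} (A B : Matrix (Fin n) (Fin n) ℂ) :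
    inner ℝ A B = rePart (A * Bᴴ).trace := by
  rw [rePart_complex, Matrix.trace]
  simp only [Matrix.diag_apply, Matrix.mul_apply, Matrix.conjTranspose_apply, Complex.re_sum]
  change (∑ i, ∑ j, inner ℝ (A i j) (B i j)) = _
  refine Finset.sum_congr rfl fun i _ => Finset.sum_congr rfl fun j _ => ?_
  simp [Complex.inner, mul_comm]

theorem matrix_inner_quaternion {n : ℕ} (A B : Matrix (Fin n) (Fin n) ℍ[ℝ]) :
    inner ℝ A B = rePart (A * Bᴴ).trace := by
  have h : ∀ x y : ℍ[ℝ], inner ℝ x y = rePart (x * star y) := fun x y => by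
    rw [rePart_quaternion, Quaternion.inner_def]
  have hs : ∀ f : Fin n → ℍ[ℝ], rePart (∑ i, f i) = ∑ i, rePart (f i) := fun f => by
    simp [rePart, inner_sum]
  rw [Matrix.trace]
  simp only [Matrix.diag_apply, Matrix.mul_apply, Matrix.conjTranspose_apply, hs, ← h]
  rfl

/-- `E(n, F)`: the traceless Hermitian `n × n` matrices over `F`, a real linear subspace of
`M(n, F)`. -/
def tracelessHermitian (n : ℕ) (F : Type*) [NormedRing F] [StarRing F] :
    Set (Matrix (Fin n) (Fin n) F) :=
  {A | Aᴴ = A ∧ A.trace = 0}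

/-- `S(n, F)`: the unit sphere of `E(n, F)`. -/
def hermitianSphere (n : ℕ) (F : Type*) [NormedRing F] [StarRing F] :
    Set (Matrix (Fin n) (Fin n) F) :=
  {A | A ∈ tracelessHermitian n F ∧ ‖A‖ = 1}

/-- The trace of the `k`-th power of `A`, as a real number (for Hermitian `A` over `ℝ`, `ℂ`, `ℍ` the
diagonal entries of `A ^ k` are real, so that taking the real part loses nothing). -/
def tracePow {n : ℕ} {F : Type*} [NormedRing F] [InnerProductSpace ℝ F] (k : ℕ)
    (A : Matrix (Fin n) (Fin n) F) : ℝ :=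
  rePart (A ^ k).trace

/-- `Φ(A) = (tr A³, tr A⁵, …, tr A²ᵖ⁺¹)` with `p = ⌊(n - 1) / 2⌋`. -/
def oddTraces (n : ℕ) (F : Type*) [NormedRing F] [InnerProductSpace ℝ F]
    (A : Matrix (Fin n) (Fin n) F) : Fin ((n - 1) / 2) → ℝ :=
  fun i => tracePow (2 * (i : ℕ) + 3) A

/-- `Φ⁻¹(0)`, the zero set of `Φ` on the sphere `S(n, F)`. -/
def oddTraceZeros (n : ℕ) (F : Type*) [NormedRing F] [StarRing F] [InnerProductSpace ℝ F] :
    Set (Matrix (Fin n) (Fin n) F) :=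
  {A | A ∈ hermitianSphere n F ∧ oddTraces n F A = 0}

/-- `A` is a regular point of the restriction of `Φ` to `S(n, F)`: the differential of `Φ` at `A` maps
the tangent space `T_A S(n, F) = {X ∈ E(n, F) | ⟪A, X⟫ = 0}` onto `ℝᵖ`. -/
def IsRegularPoint (n : ℕ) (F : Type*) [NormedRing F] [StarRing F] [InnerProductSpace ℝ F]
    (A : Matrix (Fin n) (Fin n) F) : Prop :=
  ∀ y : Fin ((n - 1) / 2) → ℝ, ∃ X ∈ tracelessHermitian n F,
    inner ℝ A X = 0 ∧ fderiv ℝ (oddTraces n F) A X = y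

/-- `ℬ(n, F)`: the regular points of `Φ` in `Φ⁻¹(0)`. -/
def regularPart (n : ℕ) (F : Type*) [NormedRing F] [StarRing F] [InnerProductSpace ℝ F] :
    Set (Matrix (Fin n) (Fin n) F) :=
  {A | A ∈ oddTraceZeros n F ∧ IsRegularPoint n F A}

/-- `𝒞(n, F)`: the critical points of `Φ` in `Φ⁻¹(0)`. -/
def singularPart (n : ℕ) (F : Type*) [NormedRing F] [StarRing F] [InnerProductSpace ℝ F] :
    Set (Matrix (Fin n) (Fin n) F) :=
  {A | A ∈ oddTraceZeros n F ∧ ¬ IsRegularPoint n F A}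

end Matrices

end

noncomputable section

/-! ### Calculus of coordinate derivatives -/

section CoordDeriv

variable {d : ℕ} {E F : Type*} [NormedAddCommGroup E] [InnerProductSpace ℝ E]
  [NormedAddCommGroup F] [NormedSpace ℝ F]

/-! At a point `A` of the zero set put `N = A² - 1/4`. On traceless Hermitian matrices the
differential of `tr A³` is `3⟨N, ·⟩`, and `N` is orthogonal to `1` and `A`, so `A` is regular
exactly when `N ≠ 0` (`isRegularPoint_iff`); moreover `|N|² = tr A⁴ - 1/4`. Inside the Hermitian
matrices, of dimension `4 + 6m`, the normal space is spanned by `1`, `A`, `N`, which leaves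
dimension `6m + 1`. Charts come from the inverse function theorem applied to `straighten`.

Differentiating the constraints `tr φ = 0`, `|φ| = 1`, `tr φ³ = 0` twice along a parametrization `φ`
gives the second fundamental form: its component is `0` along `1`, `-g` along `A`, and `-b/|N|`
along `N/|N|`, where `b(X, Y) = ⟨AX + XA, Y⟩`. The Gauss equation, contracted in
`metricScalarCurvature_eq`, then reads `s = d(d-1) + |N|⁻²((tr b)² - tr b²)` with `d = 6m + 1`. It
remains to see that `tr b = 0` and `tr b² = 2m`.

For these traces the tangent projection is written as the Hermitian projection minus three rank-one
projections. Traces over all Hermitian matrices are explicit in `m` and the `tr Aᵏ`; the three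
corrections also involve `tr A⁵` and `tr A⁶`. These are controlled because the four eigenvalues form
two opposite pairs (`power_sums_of_odd_eq_zero`); over `ℍ` the eigenvalues come from
`exists_re_trace_pow_eq_sum`. The three algebras are treated together as subalgebras of `ℍ`, the
dependence on `m` coming from `sum_rePart_mul_star_mul_self`.

Both limits follow from `|N|⁻² → ∞`, since `N = 0`, hence `tr A⁴ = 1/4`, at critical points. -/

theorem coordDeriv_congr {i : Fin d} {f g : (Fin d → ℝ) → F} {u : Fin d → ℝ}
    (h : f =ᶠ[𝓝 u] g) : coordDeriv i f u = coordDeriv i g u := by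
  rw [coordDeriv, coordDeriv, h.fderiv_eq]

theorem coordDeriv_congr_of_isOpen {i : Fin d} {f g : (Fin d → ℝ) → F} {U : Set (Fin d → ℝ)}
    (hU : IsOpen U) (h : ∀ v ∈ U, f v = g v) {u : Fin d → ℝ} (hu : u ∈ U) :
    coordDeriv i f u = coordDeriv i g u :=
  coordDeriv_congr (Filter.eventually_of_mem (hU.mem_nhds hu) h)

theorem coordDeriv_const (i : Fin d) (c : F) (u : Fin d → ℝ) :
    coordDeriv i (fun _ => c) u = 0 := by
  simp [coordDeriv]

theorem coordDeriv_inner {i : Fin d} {f g : (Fin d → ℝ) → E} {u : Fin d → ℝ}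
    (hf : DifferentiableAt ℝ f u) (hg : DifferentiableAt ℝ g u) :
    coordDeriv i (fun v => (inner ℝ (f v) (g v) : ℝ)) u =
      inner ℝ (f u) (coordDeriv i g u) + inner ℝ (coordDeriv i f u) (g u) := by
  rw [coordDeriv, fderiv_inner_apply ℝ hf hg]
  rfl

theorem coordDeriv_mul {i : Fin d} {f g : (Fin d → ℝ) → ℝ} {u : Fin d → ℝ}
    (hf : DifferentiableAt ℝ f u) (hg : DifferentiableAt ℝ g u) :
    coordDeriv i (fun v => f v * g v) u = f u * coordDeriv i g u + coordDeriv i f u * g u := by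
  rw [coordDeriv, fderiv_fun_mul hf hg]
  simp [coordDeriv, mul_comm]

theorem coordDeriv_sum {ι : Type*} {s : Finset ι} {i : Fin d} {f : ι → (Fin d → ℝ) → F}
    {u : Fin d → ℝ} (hf : ∀ a ∈ s, DifferentiableAt ℝ (f a) u) :
    coordDeriv i (fun v => ∑ a ∈ s, f a v) u = ∑ a ∈ s, coordDeriv i (f a) u := by
  rw [coordDeriv, fderiv_fun_sum hf]
  simp [coordDeriv]

theorem coordDeriv_clm_comp {G : Type*} [NormedAddCommGroup G] [NormedSpace ℝ G] (K : F →L[ℝ] G)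
    {i : Fin d} {f : (Fin d → ℝ) → F} {u : Fin d → ℝ} (hf : DifferentiableAt ℝ f u) :
    coordDeriv i (fun v => K (f v)) u = K (coordDeriv i f u) := by
  have := (K.hasFDerivAt.comp u hf.hasFDerivAt).fderiv
  rw [coordDeriv, show (fun v => K (f v)) = K ∘ f from rfl, this]
  rfl

theorem coordDeriv_bilinear {G H : Type*} [NormedAddCommGroup G] [NormedSpace ℝ G]
    [NormedAddCommGroup H] [NormedSpace ℝ H] (B : F →L[ℝ] G →L[ℝ] H)
    {i : Fin d} {f : (Fin d → ℝ) → F} {g : (Fin d → ℝ) → G} {u : Fin d → ℝ}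
    (hf : DifferentiableAt ℝ f u) (hg : DifferentiableAt ℝ g u) :
    coordDeriv i (fun v => B (f v) (g v)) u =
      B (f u) (coordDeriv i g u) + B (coordDeriv i f u) (g u) := by
  rw [coordDeriv, (B.hasFDerivAt_of_bilinear hf.hasFDerivAt hg.hasFDerivAt).fderiv]
  simp [coordDeriv]

theorem ContDiffOn.coordDeriv {f : (Fin d → ℝ) → F} {U : Set (Fin d → ℝ)} (hU : IsOpen U)
    (hf : ContDiffOn ℝ ∞ f U) (i : Fin d) : ContDiffOn ℝ ∞ (coordDeriv i f) U :=
  (hf.fderiv_of_isOpen hU (by simp)).clm_apply contDiffOn_const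

theorem ContDiffOn.differentiableAt_of_isOpen {f : (Fin d → ℝ) → F} {U : Set (Fin d → ℝ)}
    (hU : IsOpen U) (hf : ContDiffOn ℝ ∞ f U) {u : Fin d → ℝ} (hu : u ∈ U) :
    DifferentiableAt ℝ f u :=
  (hf.contDiffAt (hU.mem_nhds hu)).differentiableAt (by simp)

theorem coordDeriv_comm {f : (Fin d → ℝ) → F} {U : Set (Fin d → ℝ)} (hU : IsOpen U)
    (hf : ContDiffOn ℝ ∞ f U) {u : Fin d → ℝ} (hu : u ∈ U) (i j : Fin d) :
    coordDeriv i (coordDeriv j f) u = coordDeriv j (coordDeriv i f) u := by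
  have hfu := hf.contDiffAt (hU.mem_nhds hu)
  have hs : IsSymmSndFDerivAt ℝ f u := hfu.isSymmSndFDerivAt
    (by simpa using (mod_cast le_top : ((2 : ℕ∞) : WithTop ℕ∞) ≤ ∞))
  have hd : DifferentiableAt ℝ (fderiv ℝ f) u :=
    (hfu.fderiv_right (m := 1)
      (mod_cast le_top : ((2 : ℕ∞) : WithTop ℕ∞) ≤ ∞)).differentiableAt (by simp)
  have key : ∀ i j : Fin d, coordDeriv i (coordDeriv j f) u =
      fderiv ℝ (fderiv ℝ f) u (Pi.single i 1) (Pi.single j 1) := fun i j =>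
    coordDeriv_clm_comp (ContinuousLinearMap.apply ℝ F (Pi.single j (1 : ℝ))) hd
  rw [key, key, hs.eq]

end CoordDeriv

/-! ### The Gauss equation in coordinates -/

section Gauss

variable {d : ℕ} {E : Type*} [NormedAddCommGroup E] [InnerProductSpace ℝ E]
  {φ : (Fin d → ℝ) → E} {U : Set (Fin d → ℝ)}

/-- The vectors `∂ᵢ φ (u)` are linearly independent when `φ` is an immersion at `u`. -/
theorem linearIndependent_coordDeriv {u : Fin d → ℝ}
    (h : Function.Injective (fderiv ℝ φ u)) :
    LinearIndependent ℝ fun i => coordDeriv i φ u := by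
  have := (Pi.basisFun ℝ (Fin d)).linearIndependent.map' (fderiv ℝ φ u).toLinearMap
    (LinearMap.ker_eq_bot.2 h)
  simpa [Function.comp_def, coordDeriv] using this

theorem isUnit_firstFundamentalForm {u : Fin d → ℝ}
    (h : Function.Injective (fderiv ℝ φ u)) : IsUnit (firstFundamentalForm φ u) := by
  have : (firstFundamentalForm φ u).PosDef :=
    Matrix.posDef_gram_of_linearIndependent (linearIndependent_coordDeriv h)
  exact this.isUnit

theorem firstFundamentalForm_symm (u : Fin d → ℝ) (i j : Fin d) :
    firstFundamentalForm φ u i j = firstFundamentalForm φ u j i :=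
  real_inner_comm _ _

theorem firstFundamentalForm_inv_symm (u : Fin d → ℝ) (i j : Fin d) :
    (firstFundamentalForm φ u)⁻¹ i j = (firstFundamentalForm φ u)⁻¹ j i := by
  have h : (firstFundamentalForm φ u)ᵀ = firstFundamentalForm φ u := by
    ext i j; exact firstFundamentalForm_symm u j i
  conv_lhs => rw [← h, ← Matrix.transpose_nonsing_inv]
  rfl

theorem coordDeriv_firstFundamentalForm (hU : IsOpen U) (hφ : ContDiffOn ℝ ∞ φ U)
    {u : Fin d → ℝ} (hu : u ∈ U) (i j k : Fin d) :
    coordDeriv i (fun v => firstFundamentalForm φ v j k) u =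
      inner ℝ (coordDeriv j φ u) (coordDeriv i (coordDeriv k φ) u) +
      inner ℝ (coordDeriv i (coordDeriv j φ) u) (coordDeriv k φ u) :=
  coordDeriv_inner ((hφ.coordDeriv hU j).differentiableAt_of_isOpen hU hu)
    ((hφ.coordDeriv hU k).differentiableAt_of_isOpen hU hu)

/-- The product rule turns the three metric derivatives into six inner products. Symmetry of second
partials cancels four of them and makes the other two equal, which absorbs the factor `1/2`. -/
theorem christoffel_firstFundamentalForm (hU : IsOpen U) (hφ : ContDiffOn ℝ ∞ φ U)
    {u : Fin d → ℝ} (hu : u ∈ U) (k i j : Fin d) :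
    christoffel (firstFundamentalForm φ) k i j u = ∑ l, (firstFundamentalForm φ u)⁻¹ k l *
      inner ℝ (coordDeriv i (coordDeriv j φ) u) (coordDeriv l φ u) := by
  rw [christoffel, Finset.mul_sum]
  refine Finset.sum_congr rfl fun l _ => ?_
  rw [coordDeriv_firstFundamentalForm hU hφ hu, coordDeriv_firstFundamentalForm hU hφ hu,
    coordDeriv_firstFundamentalForm hU hφ hu, coordDeriv_comm hU hφ hu j i,
    coordDeriv_comm hU hφ hu l i, coordDeriv_comm hU hφ hu l j,
    real_inner_comm (coordDeriv j φ u)]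
  ring

theorem sum_firstFundamentalForm_mul_christoffel (hU : IsOpen U) (hφ : ContDiffOn ℝ ∞ φ U)
    (hi : ∀ u ∈ U, Function.Injective (fderiv ℝ φ u))
    {u : Fin d → ℝ} (hu : u ∈ U) (l i j : Fin d) :
    ∑ m, firstFundamentalForm φ u l m * christoffel (firstFundamentalForm φ) m i j u =
      inner ℝ (coordDeriv i (coordDeriv j φ) u) (coordDeriv l φ u) := by
  have hdet := (Matrix.isUnit_iff_isUnit_det _).1 (isUnit_firstFundamentalForm (hi u hu))
  have h : (firstFundamentalForm φ u *ᵥ ((firstFundamentalForm φ u)⁻¹ *ᵥ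
      fun l => (inner ℝ (coordDeriv i (coordDeriv j φ) u) (coordDeriv l φ u) : ℝ))) l =
      inner ℝ (coordDeriv i (coordDeriv j φ) u) (coordDeriv l φ u) := by
    rw [Matrix.mulVec_mulVec, Matrix.mul_nonsing_inv _ hdet, Matrix.one_mulVec]
  rw [← h]
  simp only [christoffel_firstFundamentalForm hU hφ hu]
  rfl

theorem differentiableAt_firstFundamentalForm (hU : IsOpen U) (hφ : ContDiffOn ℝ ∞ φ U)
    {u : Fin d → ℝ} (hu : u ∈ U) (i j : Fin d) :
    DifferentiableAt ℝ (fun v => firstFundamentalForm φ v i j) u :=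
  ((hφ.coordDeriv hU i).differentiableAt_of_isOpen hU hu).inner ℝ
    ((hφ.coordDeriv hU j).differentiableAt_of_isOpen hU hu)

theorem differentiableAt_firstFundamentalForm_inv (hU : IsOpen U) (hφ : ContDiffOn ℝ ∞ φ U)
    (hi : ∀ u ∈ U, Function.Injective (fderiv ℝ φ u))
    {u : Fin d → ℝ} (hu : u ∈ U) (i j : Fin d) :
    DifferentiableAt ℝ (fun v => (firstFundamentalForm φ v)⁻¹ i j) u := by
  obtain ⟨a, ha⟩ := isUnit_firstFundamentalForm (hi u hu)
  have h1 : DifferentiableAt ℝ (Ring.inverse : Matrix (Fin d) (Fin d) ℝ → _)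
      (firstFundamentalForm φ u) := by
    rw [← ha]
    exact differentiableAt_inverse a.isUnit
  have h2 : DifferentiableAt ℝ (firstFundamentalForm φ) u := by
    have : ∀ v, firstFundamentalForm φ v =
        ∑ i, ∑ j, (firstFundamentalForm φ v i j) • Matrix.single i j (1 : ℝ) := fun v => by
      simp only [Matrix.smul_single, smul_eq_mul, mul_one]
      exact Matrix.matrix_eq_sum_single _
    rw [funext this]
    exact DifferentiableAt.fun_sum fun i _ => DifferentiableAt.fun_sum fun j _ =>
      (differentiableAt_firstFundamentalForm hU hφ hu i j).smul_const _
  have h3 := h1.comp u h2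
  have h4 := ((LinearMap.toContinuousLinearMap
    (Matrix.entryLinearMap ℝ ℝ i j)).differentiableAt).comp u h3
  have h5 : (fun v => (firstFundamentalForm φ v)⁻¹ i j) = LinearMap.toContinuousLinearMap
      (Matrix.entryLinearMap ℝ ℝ i j) ∘ Ring.inverse ∘ firstFundamentalForm φ := by
    funext v
    rw [Matrix.nonsing_inv_eq_ringInverse]
    rfl
  rw [h5]
  exact h4

theorem differentiableAt_christoffel (hU : IsOpen U) (hφ : ContDiffOn ℝ ∞ φ U)
    (hi : ∀ u ∈ U, Function.Injective (fderiv ℝ φ u))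
    {u : Fin d → ℝ} (hu : u ∈ U) (k i j : Fin d) :
    DifferentiableAt ℝ (christoffel (firstFundamentalForm φ) k i j) u := by
  have h : DifferentiableAt ℝ (fun v => ∑ l, (firstFundamentalForm φ v)⁻¹ k l *
      inner ℝ (coordDeriv i (coordDeriv j φ) v) (coordDeriv l φ v)) u :=
    DifferentiableAt.fun_sum fun l _ =>
      (differentiableAt_firstFundamentalForm_inv hU hφ hi hu k l).mul
        ((((hφ.coordDeriv hU j).coordDeriv hU i).differentiableAt_of_isOpen hU hu).inner ℝ
          ((hφ.coordDeriv hU l).differentiableAt_of_isOpen hU hu))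
  exact h.congr_of_eventuallyEq (Filter.eventually_of_mem (hU.mem_nhds hu) fun v hv =>
    christoffel_firstFundamentalForm hU hφ hv k i j)

/-- The component of `∂ᵢ ∂ⱼ φ` orthogonal to the tangent space. -/
def secondFundamentalForm (φ : (Fin d → ℝ) → E) (i j : Fin d) (u : Fin d → ℝ) : E :=
  coordDeriv i (coordDeriv j φ) u -
    ∑ m, christoffel (firstFundamentalForm φ) m i j u • coordDeriv m φ u

/-- The Gauss equation, for the curvature tensor with its first index lowered. -/
theorem sum_firstFundamentalForm_mul_riemannTensor (hU : IsOpen U) (hφ : ContDiffOn ℝ ∞ φ U)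
    (hi : ∀ u ∈ U, Function.Injective (fderiv ℝ φ u))
    {u : Fin d → ℝ} (hu : u ∈ U) (l k i j : Fin d) :
    ∑ m, firstFundamentalForm φ u l m * riemannTensor (firstFundamentalForm φ) m k i j u =
      inner ℝ (coordDeriv i (coordDeriv l φ) u) (secondFundamentalForm φ j k u) -
      inner ℝ (coordDeriv j (coordDeriv l φ) u) (secondFundamentalForm φ i k u) := by
  have hd1 := fun a => (hφ.coordDeriv hU a).differentiableAt_of_isOpen hU hu
  have hd2 := fun a b =>
    ((hφ.coordDeriv hU b).coordDeriv hU a).differentiableAt_of_isOpen hU hu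
  have hΓ := differentiableAt_christoffel hU hφ hi hu
  -- Differentiating the identity `g Γ = ⟨∂∂φ, ∂φ⟩`, rather than `Γ` itself, avoids derivatives of
  -- the inverse metric.
  have key : ∀ i j : Fin d,
      ∑ m, firstFundamentalForm φ u l m *
        coordDeriv i (christoffel (firstFundamentalForm φ) m j k) u =
      inner ℝ (coordDeriv j (coordDeriv k φ) u) (coordDeriv i (coordDeriv l φ) u) +
      inner ℝ (coordDeriv i (coordDeriv j (coordDeriv k φ)) u) (coordDeriv l φ u) -
      ∑ m, (inner ℝ (coordDeriv l φ u) (coordDeriv i (coordDeriv m φ) u) +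
        inner ℝ (coordDeriv i (coordDeriv l φ) u) (coordDeriv m φ u)) *
        christoffel (firstFundamentalForm φ) m j k u := by
    intro i j
    have h := coordDeriv_congr_of_isOpen (i := i) hU (fun v hv =>
      sum_firstFundamentalForm_mul_christoffel hU hφ hi hv l j k) hu
    rw [coordDeriv_inner (hd2 _ _) (hd1 _),
      coordDeriv_sum (f := fun m v => firstFundamentalForm φ v l m *
        christoffel (firstFundamentalForm φ) m j k v) fun m _ =>
      (differentiableAt_firstFundamentalForm hU hφ hu l m).mul (hΓ m j k)] at h
    rw [← h, ← Finset.sum_sub_distrib]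
    refine Finset.sum_congr rfl fun m _ => ?_
    rw [coordDeriv_mul (differentiableAt_firstFundamentalForm hU hφ hu l m) (hΓ m j k),
      coordDeriv_firstFundamentalForm hU hφ hu]
    ring
  have quad : ∀ i j : Fin d,
      ∑ m, firstFundamentalForm φ u l m * ∑ r, christoffel (firstFundamentalForm φ) m i r u *
        christoffel (firstFundamentalForm φ) r j k u =
      ∑ r, inner ℝ (coordDeriv l φ u) (coordDeriv i (coordDeriv r φ) u) *
        christoffel (firstFundamentalForm φ) r j k u := by
    intro i j
    simp only [Finset.mul_sum]
    rw [Finset.sum_comm]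
    refine Finset.sum_congr rfl fun r _ => ?_
    rw [real_inner_comm, ← sum_firstFundamentalForm_mul_christoffel hU hφ hi hu l i r,
      Finset.sum_mul]
    exact Finset.sum_congr rfl fun m _ => by ring
  simp only [riemannTensor, mul_add, mul_sub, Finset.sum_add_distrib, Finset.sum_sub_distrib,
    key, quad]
  -- The two terms with third derivatives of `φ` now agree and cancel.
  rw [coordDeriv_comm hU (hφ.coordDeriv hU k) hu j i]
  simp only [secondFundamentalForm, inner_sub_right, inner_sum, real_inner_smul_right, add_mul,
    Finset.sum_add_distrib]
  rw [real_inner_comm (coordDeriv j (coordDeriv k φ) u),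
    real_inner_comm (coordDeriv i (coordDeriv k φ) u)]
  simp only [mul_comm]
  ring

/-- The scalar curvature, when the Gauss equation expresses the curvature through the metric and
one symmetric form `b`. -/
theorem metricScalarCurvature_eq (hU : IsOpen U) (hφ : ContDiffOn ℝ ∞ φ U)
    (hi : ∀ u ∈ U, Function.Injective (fderiv ℝ φ u)) {u : Fin d → ℝ} (hu : u ∈ U)
    (b : Fin d → Fin d → ℝ) (c : ℝ)
    (hb : ∀ i j k l, inner ℝ (coordDeriv i (coordDeriv l φ) u) (secondFundamentalForm φ j k u) =
      firstFundamentalForm φ u i l * firstFundamentalForm φ u j k + c * (b i l * b j k)) :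
    metricScalarCurvature (firstFundamentalForm φ) u = d * (d - 1) +
      c * ((∑ i, ∑ j, (firstFundamentalForm φ u)⁻¹ i j * b i j) ^ 2 -
        ∑ j, ∑ k, ∑ i, ∑ l, (firstFundamentalForm φ u)⁻¹ j k *
          (firstFundamentalForm φ u)⁻¹ i l * (b j l * b i k)) := by
  set g := firstFundamentalForm φ u with hg
  have hdet := (Matrix.isUnit_iff_isUnit_det _).1 (isUnit_firstFundamentalForm (hi u hu))
  have hGg : ∀ i j, ∑ l, g⁻¹ i l * g l j = if i = j then 1 else 0 := fun i j => by
    rw [← Matrix.mul_apply, Matrix.nonsing_inv_mul _ hdet, Matrix.one_apply]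
  have hR : ∀ m k i j, riemannTensor (firstFundamentalForm φ) m k i j u =
      ∑ l, g⁻¹ m l * (g i l * g j k + c * (b i l * b j k) - g j l * g i k
        - c * (b j l * b i k)) := by
    intro m k i j
    -- Inserting `g⁻¹ g = 1` lowers the first index, so that the Gauss equation applies.
    have h1 : (g⁻¹ *ᵥ (g *ᵥ fun m => riemannTensor (firstFundamentalForm φ) m k i j u)) m =
        riemannTensor (firstFundamentalForm φ) m k i j u := by
      rw [Matrix.mulVec_mulVec, Matrix.nonsing_inv_mul _ hdet, Matrix.one_mulVec]
    rw [← h1]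
    change ∑ l, g⁻¹ m l * (g *ᵥ fun m => riemannTensor (firstFundamentalForm φ) m k i j u) l = _
    refine Finset.sum_congr rfl fun l _ => congrArg (g⁻¹ m l * ·) ?_
    refine (sum_firstFundamentalForm_mul_riemannTensor hU hφ hi hu l k i j).trans ?_
    rw [hb, hb]
    ring
  have hsymm : ∀ i j, g i j = g j i := firstFundamentalForm_symm u
  have hGsymm : ∀ i j, g⁻¹ i j = g⁻¹ j i := firstFundamentalForm_inv_symm u
  have hgG : ∀ i j, ∑ l, g⁻¹ i l * g j l = if i = j then 1 else 0 := fun i j => by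
    simp only [hsymm j]; exact hGg i j
  have hRic : ∀ j k, ricciTensor (firstFundamentalForm φ) j k u =
      (d - 1) * g j k + c * ((∑ i, ∑ l, g⁻¹ i l * b i l) * b j k -
        ∑ i, ∑ l, g⁻¹ i l * (b j l * b i k)) := by
    intro j k
    have h1 : ∀ i, riemannTensor (firstFundamentalForm φ) i k i j u =
        (∑ l, g⁻¹ i l * g i l) * g j k + c * ((∑ l, g⁻¹ i l * b i l) * b j k) -
        (∑ l, g⁻¹ i l * g j l) * g i k - c * ∑ l, g⁻¹ i l * (b j l * b i k) := by
      intro i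
      rw [hR]
      simp only [Finset.sum_mul, Finset.mul_sum, ← Finset.sum_add_distrib,
        ← Finset.sum_sub_distrib]
      exact Finset.sum_congr rfl fun l _ => by ring
    simp only [ricciTensor, h1, hgG, Finset.sum_sub_distrib, Finset.sum_add_distrib,
      ← Finset.mul_sum, ← Finset.sum_mul]
    simp
    ring
  have htr : ∑ j, ∑ k, g⁻¹ j k * g j k = d := by
    simp [hgG]
  have h2 : ∀ j k, g⁻¹ j k * ricciTensor (firstFundamentalForm φ) j k u =
      (d - 1) * (g⁻¹ j k * g j k) + c * ((∑ i, ∑ l, g⁻¹ i l * b i l) * (g⁻¹ j k * b j k)) -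
      c * ∑ i, ∑ l, g⁻¹ j k * g⁻¹ i l * (b j l * b i k) := by
    intro j k
    rw [hRic]
    simp only [mul_assoc, ← Finset.mul_sum]
    ring
  rw [metricScalarCurvature]
  simp only [← hg, h2, Finset.sum_sub_distrib, Finset.sum_add_distrib, ← Finset.mul_sum, htr]
  ring

end Gauss

/-! ### Submanifolds straightened by a local diffeomorphism -/

section Straightening

variable {E : Type*} [NormedAddCommGroup E] [InnerProductSpace ℝ E] [FiniteDimensional ℝ E]

/-- A smooth map with injective derivative at `p` that maps `M`, near `p`, onto a `d`-dimensional
linear subspace provides a local parametrization of `M` around `p`. -/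
theorem exists_isLocalParametrization {d : ℕ} {M V : Set E} {p : E} (hV : IsOpen V) (hpV : p ∈ V)
    (hpM : p ∈ M) {Ψ : E → E} (hΨ : ContDiff ℝ ∞ Ψ) (hinj : Function.Injective (fderiv ℝ Ψ p))
    (T : Submodule ℝ E) (hT : Module.finrank ℝ T = d) (hM : ∀ x ∈ V, x ∈ M ↔ Ψ x ∈ T) :
    ∃ (U : Set (Fin d → ℝ)) (φ : (Fin d → ℝ) → E),
      IsLocalParametrization M U φ ∧ ∃ u ∈ U, φ u = p := by
  have : CompleteSpace E := FiniteDimensional.complete ℝ E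
  have hd : Differentiable ℝ Ψ := hΨ.differentiable (by simp)
  have hequiv : ∀ f : E →L[ℝ] E, Function.Injective f → ∃ e : E ≃L[ℝ] E, (e : E →L[ℝ] E) = f :=
    fun f hf => ⟨(LinearEquiv.ofInjectiveEndo f.toLinearMap hf).toContinuousLinearEquiv, by
      ext; rfl⟩
  obtain ⟨e, he⟩ := hequiv _ hinj
  -- Keeping only points where the derivative is invertible makes the local inverse smooth on its
  -- whole target, not just at the image of `p`.
  let V' : Set E := V ∩ {x | fderiv ℝ Ψ x ∈
    Set.range ((↑) : (E ≃L[ℝ] E) → (E →L[ℝ] E))}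
  have hV' : IsOpen V' := hV.inter
    (ContinuousLinearEquiv.isOpen.preimage (hΨ.continuous_fderiv (by simp)))
  have hat : HasFDerivAt Ψ (e : E →L[ℝ] E) p := he ▸ (hd p).hasFDerivAt
  let Φ := (hΨ.contDiffAt (x := p)).toOpenPartialHomeomorph Ψ hat (by simp)
  let Φ' := Φ.restrOpen V' hV'
  have hpΦ : p ∈ Φ'.source :=
    ⟨ContDiffAt.mem_toOpenPartialHomeomorph_source hΨ.contDiffAt hat (by simp), hpV, e, he⟩
  have hsub : Φ'.source ⊆ V' := Set.inter_subset_right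
  have hsymm : ∀ y ∈ Φ'.target, ContDiffAt ℝ ∞ Φ'.symm y := by
    intro y hy
    obtain ⟨e', he'⟩ := (hsub (Φ'.map_target hy)).2
    exact Φ'.contDiffAt_symm hy (f₀' := e') (he' ▸ (hd _).hasFDerivAt) hΨ.contDiffAt
  let κ : (Fin d → ℝ) ≃L[ℝ] T := ContinuousLinearEquiv.ofFinrankEq (by simp [hT])
  let ι : (Fin d → ℝ) →L[ℝ] E := T.subtypeL ∘L (κ : (Fin d → ℝ) →L[ℝ] T)
  have hιT : ∀ u, ι u ∈ T := fun u => (κ u).2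
  have hιinj : Function.Injective ι := Subtype.val_injective.comp κ.injective
  let U : Set (Fin d → ℝ) := ι ⁻¹' Φ'.target
  have hU : IsOpen U := Φ'.open_target.preimage ι.continuous
  have hΨφ : ∀ u ∈ U, Ψ (Φ'.symm (ι u)) = ι u := fun u hu => Φ'.right_inv hu
  have hsm : ContDiffOn ℝ ∞ (fun u => Φ'.symm (ι u)) U := fun u hu =>
    ((hsymm _ hu).comp u ι.contDiff.contDiffAt).contDiffWithinAt
  refine ⟨U, fun u => Φ'.symm (ι u), ⟨hU, hsm, ?_, ?_, Φ'.source, Φ'.open_source, ?_⟩, ?_⟩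
  · intro u hu
    have h1 : DifferentiableAt ℝ (fun u => Φ'.symm (ι u)) u :=
      hsm.differentiableAt_of_isOpen hU hu
    -- Composed with `Ψ` the parametrization is the injective linear map `ι`; by the chain rule its
    -- derivative is injective.
    have h2 : fderiv ℝ (fun u => Ψ (Φ'.symm (ι u))) u = ι := by
      have : (fun u => Ψ (Φ'.symm (ι u))) =ᶠ[𝓝 u] ι :=
        Filter.eventually_of_mem (hU.mem_nhds hu) hΨφ
      rw [this.fderiv_eq, ι.fderiv]
    have h3 := ((hd _).hasFDerivAt.comp u h1.hasFDerivAt).fderiv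
    have h4 : ∀ w, fderiv ℝ Ψ (Φ'.symm (ι u)) (fderiv ℝ (fun u => Φ'.symm (ι u)) u w) = ι w := by
      intro w
      have h5 := congrArg (fun f : (Fin d → ℝ) →L[ℝ] E => f w) h3
      exact h5.symm.trans (congrArg (fun f : (Fin d → ℝ) →L[ℝ] E => f w) h2)
    intro a b hab
    exact hιinj ((h4 a).symm.trans ((congrArg _ hab).trans (h4 b)))
  · refine Topology.IsEmbedding.of_comp hsm.continuousOn.domRestrict hΨ.continuous ?_
    have : (Ψ ∘ fun u : U => Φ'.symm (ι u)) = fun u : U => ι u := by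
      funext u
      exact hΨφ u u.2
    rw [this]
    exact (Topology.IsEmbedding.subtypeVal.comp κ.toHomeomorph.isEmbedding).comp
      Topology.IsEmbedding.subtypeVal
  · ext x
    constructor
    · rintro ⟨u, hu, rfl⟩
      have hs := Φ'.map_target hu
      refine ⟨(hM _ (hsub hs).1).2 ?_, hs⟩
      rw [hΨφ u hu]
      exact hιT u
    · rintro ⟨hxM, hxs⟩
      have hx := (hM x (hsub hxs).1).1 hxM
      have hι : ι (κ.symm ⟨Ψ x, hx⟩) = Ψ x := by simp [ι]
      refine ⟨κ.symm ⟨Ψ x, hx⟩, ?_, ?_⟩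
      · change ι _ ∈ Φ'.target
        rw [hι]
        exact Φ'.map_source hxs
      · change Φ'.symm (ι _) = x
        rw [hι]
        exact Φ'.left_inv hxs
  · have hx := (hM p hpV).1 hpM
    have hι : ι (κ.symm ⟨Ψ p, hx⟩) = Ψ p := by simp [ι]
    refine ⟨κ.symm ⟨Ψ p, hx⟩, ?_, ?_⟩
    · change ι _ ∈ Φ'.target
      rw [hι]
      exact Φ'.map_source hpΦ
    · change Φ'.symm (ι _) = p
      rw [hι]
      exact Φ'.left_inv hpΦ

end Straightening

/-! ### Traces over the range of a projection -/

section ProjectionTrace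

variable {E : Type*} [NormedAddCommGroup E] [InnerProductSpace ℝ E] [FiniteDimensional ℝ E]

open InnerProductSpace

/-- The trace of a linear map in terms of a resolution of the identity. -/
theorem trace_eq_sum_inner_of_resolution {ι : Type*} [Fintype ι] (e : ι → E)
    (he : ∀ x, ∑ a, (inner ℝ (e a) x : ℝ) • e a = x) (L : E →ₗ[ℝ] E) :
    LinearMap.trace ℝ E L = ∑ a, inner ℝ (e a) (L (e a)) := by
  have h : L = ∑ a, (rankOne ℝ (L (e a)) (e a) : E →L[ℝ] E).toLinearMap := by
    ext x
    conv_lhs => rw [← he x]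
    simp
  conv_lhs => rw [h]
  simp [trace_rankOne]

/-- The endomorphism `S - ∑ |ν⟩⟨ν|`. -/
def removeDirections {κ : Type*} [Fintype κ] (S : E →ₗ[ℝ] E) (ν : κ → E) : E →ₗ[ℝ] E :=
  S - ∑ a, (rankOne ℝ (ν a) (ν a) : E →L[ℝ] E).toLinearMap

omit [FiniteDimensional ℝ E] in
theorem removeDirections_apply {κ : Type*} [Fintype κ] (S : E →ₗ[ℝ] E) (ν : κ → E) (x : E) :
    removeDirections S ν x = S x - ∑ a, (inner ℝ (ν a) x : ℝ) • ν a := by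
  simp [removeDirections]

variable {κ : Type*} [Fintype κ] {S L : E →ₗ[ℝ] E} {ν : κ → E}

theorem trace_removeDirections :
    LinearMap.trace ℝ E (removeDirections S ν) =
      LinearMap.trace ℝ E S - ∑ a, inner ℝ (ν a) (ν a) := by
  simp [removeDirections, trace_rankOne]

theorem trace_comp_removeDirections :
    LinearMap.trace ℝ E (L ∘ₗ removeDirections S ν) =
      LinearMap.trace ℝ E (L ∘ₗ S) - ∑ a, inner ℝ (ν a) (L (ν a)) := by
  have h : L ∘ₗ removeDirections S ν =
      L ∘ₗ S - ∑ a, (rankOne ℝ (L (ν a)) (ν a) : E →L[ℝ] E).toLinearMap := by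
    ext x
    simp [removeDirections_apply]
  rw [h]
  simp [trace_rankOne]

theorem trace_comp_removeDirections_sq (hS : ∀ x y, inner ℝ (S x) y = (inner ℝ x (S y) : ℝ))
    (hSS : ∀ x, S (S x) = S x) (hL : ∀ x y, inner ℝ (L x) y = (inner ℝ x (L y) : ℝ))
    (hLS : ∀ x, L (S x) = S (L x)) (hν : ∀ a, S (ν a) = ν a) :
    LinearMap.trace ℝ E (L ∘ₗ removeDirections S ν ∘ₗ L ∘ₗ removeDirections S ν) =
      LinearMap.trace ℝ E (L ∘ₗ L ∘ₗ S) - 2 * ∑ a, inner ℝ (L (ν a)) (L (ν a)) +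
        ∑ a, ∑ b, (inner ℝ (L (ν a)) (ν b)) ^ 2 := by
  -- Since `S` commutes with `L` and fixes every `ν a`, all terms of the expansion except the first
  -- are sums of rank-one maps.
  have h : L ∘ₗ removeDirections S ν ∘ₗ L ∘ₗ removeDirections S ν = L ∘ₗ L ∘ₗ S -
      ∑ a, (rankOne ℝ (L (ν a)) (L (ν a)) : E →L[ℝ] E).toLinearMap -
      ∑ a, (rankOne ℝ (L (L (ν a))) (ν a) : E →L[ℝ] E).toLinearMap +
      ∑ a, ∑ b, (inner ℝ (L (ν a)) (ν b)) •
        (rankOne ℝ (L (ν b)) (ν a) : E →L[ℝ] E).toLinearMap := by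
    have hSL : ∀ a, S (L (ν a)) = L (ν a) := fun a => by rw [← hLS, hν]
    have h0 : ∀ y, L (removeDirections S ν y) = L (S y) - ∑ a, (inner ℝ (ν a) y : ℝ) • L (ν a) :=
      fun y => by simp [removeDirections_apply]
    have h1 : ∀ a x, (inner ℝ (ν a) (L (S x)) : ℝ) = inner ℝ (L (ν a)) x := fun a x => by
      rw [← hL, ← hS, hSL]
    ext x
    have h2 : L (S (L (removeDirections S ν x))) =
        L (L (S x)) - ∑ a, (inner ℝ (ν a) x : ℝ) • L (L (ν a)) := by
      rw [h0, map_sub, ← hLS, hSS, map_sub, map_sum, map_sum]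
      simp only [map_smul, hSL]
    have h3 : ∀ b, (inner ℝ (ν b) (L (removeDirections S ν x)) : ℝ) = inner ℝ (L (ν b)) x -
        ∑ a, inner ℝ (ν a) x * inner ℝ (L (ν a)) (ν b) := fun b => by
      simp [h0, inner_sub_right, h1, inner_sum, inner_smul_right, real_inner_comm (ν b)]
    simp only [LinearMap.comp_apply]
    rw [h0 (L (removeDirections S ν x)), h2]
    simp only [h3, sub_smul, Finset.sum_sub_distrib, Finset.sum_smul]
    rw [Finset.sum_comm (γ := κ)]
    simp [smul_smul, mul_comm]
    abel
  rw [h]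
  simp only [map_add, map_sub, map_sum, map_smul, trace_rankOne, smul_eq_mul]
  have h2 : ∀ a, (inner ℝ (ν a) (L (L (ν a))) : ℝ) = inner ℝ (L (ν a)) (L (ν a)) := fun a =>
    (hL _ _).symm
  have h3 : ∀ a b, (inner ℝ (ν a) (L (ν b)) : ℝ) = inner ℝ (L (ν a)) (ν b) := fun a b =>
    (hL _ _).symm
  simp only [h2, h3, sq]
  ring

omit [FiniteDimensional ℝ E] in
-- The left side is `P x` with `P = ∑ Gᵢⱼ |vᵢ⟩⟨vⱼ|`. As `G` is a left inverse of the Gram matrix,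
-- `P` fixes the span of `v`; as `Q` is symmetric and fixes each `vⱼ`, `P x = P (Q x)`. Hence `P x =
-- Q x`.
theorem sum_gram_inv_smul {d : ℕ} (v : Fin d → E) (G : Matrix (Fin d) (Fin d) ℝ)
    (hG : ∀ i j, ∑ l, G i l * inner ℝ (v l) (v j) = if i = j then 1 else 0)
    {Q : E →ₗ[ℝ] E} (hQ : ∀ x y, inner ℝ (Q x) y = (inner ℝ x (Q y) : ℝ))
    (hQv : ∀ i, Q (v i) = v i) (hspan : ∀ x, Q x ∈ Submodule.span ℝ (Set.range v)) (x : E) :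
    ∑ i, ∑ j, (G i j * inner ℝ (v j) x) • v i = Q x := by
  let P : E →ₗ[ℝ] E := ∑ i, ∑ j, G i j • (rankOne ℝ (v i) (v j) : E →L[ℝ] E).toLinearMap
  have hP : ∀ y, P y = ∑ i, ∑ j, (G i j * inner ℝ (v j) y) • v i := fun y => by
    simp [P, smul_smul]
  have hPv : ∀ y ∈ Submodule.span ℝ (Set.range v), P y = y := by
    intro y hy
    induction hy using Submodule.span_induction with
    | mem y hy =>
      obtain ⟨k, rfl⟩ := hy
      simp [hP, ← Finset.sum_smul, hG]
    | zero => simp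
    | add y z _ _ hy hz => rw [map_add, hy, hz]
    | smul a y _ hy => rw [map_smul, hy]
  rw [← hP, ← hPv _ (hspan x), hP, hP]
  simp only [← hQ, hQv]

/-- Turns contractions with the inverse metric into traces on the ambient space, so that no
orthonormal tangent frame is needed. -/
theorem sum_gram_inv_mul_inner {d : ℕ} (v : Fin d → E) (G : Matrix (Fin d) (Fin d) ℝ)
    {Q : E →ₗ[ℝ] E} (hQ : ∀ x, ∑ i, ∑ j, (G i j * inner ℝ (v j) x) • v i = Q x)
    (L : E →ₗ[ℝ] E) :
    ∑ i, ∑ j, G i j * inner ℝ (v j) (L (v i)) = LinearMap.trace ℝ E (L ∘ₗ Q) := by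
  have h : L ∘ₗ Q = ∑ i, ∑ j, G i j • (rankOne ℝ (L (v i)) (v j) : E →L[ℝ] E).toLinearMap := by
    ext x
    simp [← hQ, smul_smul]
  rw [h]
  simp [trace_rankOne]

end ProjectionTrace

/-! ### Power sums of Hermitian quaternionic matrices -/

section PowerSums

theorem Quaternion.re_mul_comm (x y : ℍ[ℝ]) : (x * y).re = (y * x).re := by
  simp only [Quaternion.re_mul]
  ring

theorem Quaternion.re_finset_sum {ι : Type*} (s : Finset ι) (f : ι → ℍ[ℝ]) :
    (∑ i ∈ s, f i).re = ∑ i ∈ s, (f i).re :=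
  map_sum (QuaternionAlgebra.reₗ (R := ℝ) (-1) 0 (-1)) f s

variable {n : ℕ}

/-- Left multiplication by a quaternionic matrix on the Hilbert space `ℍⁿ`. -/
def quaternionMulVec (A : Matrix (Fin n) (Fin n) ℍ[ℝ]) :
    Module.End ℝ (PiLp 2 fun _ : Fin n => ℍ[ℝ]) where
  toFun x := WithLp.toLp 2 (A *ᵥ x.ofLp)
  map_add' x y := by simp [Matrix.mulVec_add]
  map_smul' r x := by simp [Matrix.mulVec_smul]

theorem quaternionMulVec_apply (A : Matrix (Fin n) (Fin n) ℍ[ℝ])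
    (x : PiLp 2 fun _ : Fin n => ℍ[ℝ]) (i : Fin n) :
    quaternionMulVec A x i = ∑ j, A i j * x j := rfl

theorem quaternionMulVec_pow (A : Matrix (Fin n) (Fin n) ℍ[ℝ]) (k : ℕ) :
    quaternionMulVec (A ^ k) = quaternionMulVec A ^ k := by
  induction k with
  | zero =>
    ext x i
    all_goals simp [quaternionMulVec]
  | succ k ih =>
    rw [pow_succ, pow_succ, ← ih]
    refine LinearMap.ext fun x => ?_
    simp [quaternionMulVec, Matrix.mulVec_mulVec]

theorem isSymmetric_quaternionMulVec {A : Matrix (Fin n) (Fin n) ℍ[ℝ]} (hA : Aᴴ = A) :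
    (quaternionMulVec A).IsSymmetric := by
  intro x y
  simp only [PiLp.inner_apply, quaternionMulVec_apply, Quaternion.inner_def, Finset.sum_mul,
    star_sum, Finset.mul_sum, Quaternion.re_finset_sum]
  rw [Finset.sum_comm]
  refine Finset.sum_congr rfl fun i _ => Finset.sum_congr rfl fun j _ => ?_
  rw [star_mul, ← Matrix.conjTranspose_apply, hA, mul_assoc, Quaternion.re_mul_comm, mul_assoc]

/-- In the real orthonormal basis `eᵢ bₖ` the diagonal coefficient is `⟨bₖ, Aᵢᵢ bₖ⟩ = Re Aᵢᵢ`,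
because `|bₖ| = 1`; there are four values of `k`. -/
theorem trace_quaternionMulVec (A : Matrix (Fin n) (Fin n) ℍ[ℝ]) :
    LinearMap.trace ℝ _ (quaternionMulVec A) = 4 * A.trace.re := by
  let b := stdOrthonormalBasis ℝ ℍ[ℝ]
  have hres : ∀ x : PiLp 2 fun _ : Fin n => ℍ[ℝ],
      ∑ a : Fin n × Fin (Module.finrank ℝ ℍ[ℝ]),
        (inner ℝ (WithLp.toLp 2 (Pi.single a.1 (b a.2)) : PiLp 2 fun _ : Fin n => ℍ[ℝ]) x : ℝ) •
          (WithLp.toLp 2 (Pi.single a.1 (b a.2)) : PiLp 2 fun _ : Fin n => ℍ[ℝ]) = x := by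
    intro x
    ext1 i
    rw [Fintype.sum_prod_type]
    have h := b.sum_repr' (x i)
    have h1 : ∀ j k, (inner ℝ (WithLp.toLp 2 (Pi.single j (b k)) :
        PiLp 2 fun _ : Fin n => ℍ[ℝ]) x : ℝ) = inner ℝ (b k) (x j) := fun j k => by
      rw [PiLp.inner_apply, Finset.sum_eq_single j]
      · simp
      · intro i _ hi
        simp [Pi.single_eq_of_ne hi]
      · simp
    simp only [h1]
    rw [WithLp.ofLp_sum, Finset.sum_apply, Finset.sum_eq_single i]
    · conv_rhs => rw [← h]
      simp
    · intro j _ hj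
      simp [Pi.single_eq_of_ne hj.symm]
    · simp
  rw [trace_eq_sum_inner_of_resolution _ hres, Fintype.sum_prod_type, Matrix.trace,
    Quaternion.re_finset_sum, Finset.mul_sum]
  refine Finset.sum_congr rfl fun i _ => ?_
  have h1 : ∀ k, (inner ℝ (WithLp.toLp 2 (Pi.single i (b k)) : PiLp 2 fun _ : Fin n => ℍ[ℝ])
      (quaternionMulVec A (WithLp.toLp 2 (Pi.single i (b k)))) : ℝ) = (A i i).re := fun k => by
    have hb : b k * star (b k) = 1 := by
      rw [Quaternion.self_mul_star, Quaternion.normSq_eq_norm_mul_self, b.norm_eq_one]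
      simp
    rw [PiLp.inner_apply, Finset.sum_eq_single i]
    · rw [quaternionMulVec_apply, Finset.sum_eq_single i]
      · simp [Quaternion.inner_def, ← mul_assoc, hb]
      · intro j _ hj
        simp [Pi.single_eq_of_ne hj]
      · simp
    · intro j _ hj
      simp [Pi.single_eq_of_ne hj]
    · simp
  refine (Finset.sum_congr rfl fun k _ => h1 k).trans ?_
  simp [Quaternion.finrank_eq_four]

/-- Left multiplication by `A` commutes with right scalars, so a real eigenspace is a module over
`ℍᵐᵒᵖ`, and the tower law for dimensions supplies the factor 4. -/
theorem four_dvd_finrank_eigenspace (A : Matrix (Fin n) (Fin n) ℍ[ℝ]) (μ : ℝ) :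
    4 ∣ Module.finrank ℝ (Module.End.eigenspace (quaternionMulVec A) μ) := by
  let N : Submodule ℍ[ℝ]ᵐᵒᵖ (PiLp 2 fun _ : Fin n => ℍ[ℝ]) :=
    { carrier := {x | quaternionMulVec A x = μ • x}
      add_mem' := fun {x y} hx hy => by
        simp only [Set.mem_ofPred_eq] at *
        rw [map_add, hx, hy, smul_add]
      zero_mem' := by simp
      smul_mem' := fun q x hx => by
        simp only [Set.mem_ofPred_eq] at *
        rw [smul_comm, ← hx]
        ext1 i
        simp [quaternionMulVec_apply, Finset.sum_mul, mul_assoc] }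
  have h : Module.finrank ℝ N = Module.finrank ℝ (Module.End.eigenspace (quaternionMulVec A) μ) := by
    have : N.restrictScalars ℝ = Module.End.eigenspace (quaternionMulVec A) μ := by
      ext x
      exact Module.End.mem_eigenspace_iff.symm
    rw [← this]
    rfl
  rw [← h, ← Module.finrank_mul_finrank ℝ ℍ[ℝ]ᵐᵒᵖ N,
    ← (MulOpposite.opLinearEquiv ℝ (M := ℍ[ℝ])).finrank_eq, Quaternion.finrank_eq_four]
  exact dvd_mul_right _ _

/-- The symmetric real operator on `ℍⁿ` is diagonalizable. Counting each eigenvalue with a quarter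
of its real multiplicity compensates the factor 4 in `trace_quaternionMulVec`, and no quaternionic
spectral theorem is needed. -/
theorem exists_re_trace_pow_eq_sum {A : Matrix (Fin n) (Fin n) ℍ[ℝ]} (hA : Aᴴ = A) :
    ∃ l : Fin n → ℝ, ∀ k : ℕ, (A ^ k).trace.re = ∑ i, l i ^ k := by
  classical
  let T := quaternionMulVec A
  have hT : T.IsSymmetric := isSymmetric_quaternionMulVec hA
  choose w hw using fun μ => four_dvd_finrank_eigenspace A μ
  have htr : ∀ k : ℕ, (A ^ k).trace.re = ∑ μ : T.Eigenvalues, (w μ : ℝ) * (μ : ℝ) ^ k := by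
    intro k
    have hpow : ∀ (μ : T.Eigenvalues), ∀ x ∈ Module.End.eigenspace T μ,
        (T ^ k) x = (μ : ℝ) ^ k • x := fun μ x hx => by
      induction k with
      | zero => simp
      | succ k ih =>
        rw [pow_succ, Module.End.mul_apply, Module.End.mem_eigenspace_iff.1 hx, map_smul, ih,
          smul_smul, pow_succ, mul_comm]
    have hmap : ∀ μ : T.Eigenvalues, Set.MapsTo (T ^ k) (Module.End.eigenspace T μ : Set _)
        (Module.End.eigenspace T μ) := fun μ x hx => by
      rw [hpow μ x hx]
      exact Submodule.smul_mem _ _ hx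
    have h1 := LinearMap.trace_eq_sum_trace_restrict hT.direct_sum_isInternal (f := T ^ k) hmap
    have h2 : ∀ μ : T.Eigenvalues, (T ^ k).restrict (hmap μ) = (μ : ℝ) ^ k • LinearMap.id :=
      fun μ => by
        ext1 x
        exact Subtype.ext (hpow μ x x.2)
    have h3 : LinearMap.trace ℝ _ (T ^ k) = 4 * (A ^ k).trace.re := by
      rw [← quaternionMulVec_pow, trace_quaternionMulVec]
    rw [h3] at h1
    refine mul_left_cancel₀ (four_ne_zero (α := ℝ)) (h1.trans ?_)
    rw [Finset.mul_sum]
    refine Finset.sum_congr rfl fun μ _ => ?_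
    rw [h2, map_smul, LinearMap.trace_id, hw]
    push_cast
    simp only [smul_eq_mul]
    ring
  let s : Multiset ℝ := ∑ μ : T.Eigenvalues, Multiset.replicate (w μ) (μ : ℝ)
  have hs : ∀ k : ℕ, (s.map (· ^ k)).sum = (A ^ k).trace.re := by
    intro k
    let f : Multiset ℝ →+ ℝ :=
      Multiset.sumAddMonoidHom.comp (Multiset.mapAddMonoidHom (· ^ k))
    rw [htr]
    change f s = _
    simp [s, f]
  -- The exponent `k = 0` counts the eigenvalues, since `tr 1 = n`.
  have hcard : s.card = n := by
    have := hs 0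
    simp only [pow_zero, Multiset.map_const', Multiset.sum_replicate, Matrix.trace_one,
      Fintype.card_fin] at this
    simpa using this
  refine ⟨fun i => s.toList.get (i.cast (by simp [hcard])), fun k => ?_⟩
  rw [← hs]
  conv_lhs => rw [← s.coe_toList]
  rw [Multiset.map_coe, Multiset.sum_coe, ← Fin.sum_univ_getElem]
  have hl : n = (s.toList.map (· ^ k)).length := by simp [hcard]
  refine (Fintype.sum_equiv (finCongr hl) _ _ fun i => ?_).symm
  simp

/-- Four real numbers whose first and third power sums vanish form two opposite pairs. -/
theorem power_sums_of_odd_eq_zero (l : Fin 4 → ℝ) (h1 : ∑ i, l i ^ 1 = 0) (h2 : ∑ i, l i ^ 2 = 1)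
    (h3 : ∑ i, l i ^ 3 = 0) :
    ∑ i, l i ^ 5 = 0 ∧ ∑ i, l i ^ 6 = 3 / 4 * ∑ i, l i ^ 4 - 1 / 8 := by
  have pairs : ∀ a b c d : ℝ, a + b = 0 → c + d = 0 → a ^ 2 + b ^ 2 + c ^ 2 + d ^ 2 = 1 →
      a ^ 5 + b ^ 5 + c ^ 5 + d ^ 5 = 0 ∧ a ^ 6 + b ^ 6 + c ^ 6 + d ^ 6 =
        3 / 4 * (a ^ 4 + b ^ 4 + c ^ 4 + d ^ 4) - 1 / 8 := by
    intro a b c d hab hcd h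
    obtain rfl : b = -a := by linarith
    obtain rfl : d = -c := by linarith
    refine ⟨by ring, ?_⟩
    have hc : c ^ 2 = 1 / 2 - a ^ 2 := by linarith
    rw [show (-a) ^ 6 = a ^ 6 by ring, show (-c) ^ 6 = (c ^ 2) ^ 3 by ring,
      show (-a) ^ 4 = a ^ 4 by ring, show (-c) ^ 4 = (c ^ 2) ^ 2 by ring,
      show c ^ 6 = (c ^ 2) ^ 3 by ring, show c ^ 4 = (c ^ 2) ^ 2 by ring, hc]
    ring
  simp only [Fin.sum_univ_four] at *
  generalize l 0 = a at *
  generalize l 1 = b at *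
  generalize l 2 = c at *
  generalize l 3 = d at *
  -- With `d = -(a + b + c)` the sum of cubes is `-3(a + b)(b + c)(c + a)`.
  have hprod : (a + b) * ((b + c) * (c + a)) = 0 := by
    have hd : d = -(a + b + c) := by linarith
    rw [hd] at h3
    linarith [h3]
  rcases mul_eq_zero.1 hprod with h | h
  · exact pairs a b c d h (by linarith) h2
  rcases mul_eq_zero.1 h with h | h
  · have := pairs b c a d h (by linarith) (by linarith)
    constructor <;> linarith [this.1, this.2]
  · have := pairs c a b d h (by linarith) (by linarith)
    constructor <;> linarith [this.1, this.2]

end PowerSums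

/-! ### The algebras `ℝ`, `ℂ`, `ℍ` -/

section Algebras

/-- `F` is a real normed star subalgebra of the quaternions. -/
class IsQuaternionSubalgebra (F : Type*) [NormedRing F] [StarRing F] [InnerProductSpace ℝ F] :
    Prop where
  exists_embedding : ∃ ι : F →+* ℍ[ℝ], (∀ (r : ℝ) (x : F), ι (r • x) = r • ι x) ∧
    (∀ x, ι (star x) = star (ι x)) ∧ ∀ x, ‖ι x‖ = ‖x‖

instance : IsQuaternionSubalgebra ℝ where
  exists_embedding := ⟨algebraMap ℝ ℍ[ℝ], fun r x => by simp [Algebra.smul_def],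
    fun x => by simp, fun x => by simp⟩

instance : IsQuaternionSubalgebra ℂ where
  exists_embedding := ⟨Quaternion.ofComplex, fun r x => by simp, fun x => by
    ext <;> simp, fun x => by
    rw [← sq_eq_sq₀ (norm_nonneg _) (norm_nonneg _), sq, ← Quaternion.normSq_eq_norm_mul_self,
      Quaternion.normSq_def', Complex.sq_norm, Complex.normSq_apply]
    simp
    ring⟩

instance : IsQuaternionSubalgebra ℍ[ℝ] where
  exists_embedding := ⟨RingHom.id _, fun _ _ => rfl, fun _ => rfl, fun _ => rfl⟩

variable (F : Type*) [NormedRing F] [StarRing F] [InnerProductSpace ℝ F]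
  [hF : IsQuaternionSubalgebra F]

/-- The embedding of `F` into the quaternions. -/
def quaternionEmbedding : F →+* ℍ[ℝ] := hF.exists_embedding.choose

variable {F}

theorem quaternionEmbedding_smul (r : ℝ) (x : F) :
    quaternionEmbedding F (r • x) = r • quaternionEmbedding F x :=
  hF.exists_embedding.choose_spec.1 r x

theorem quaternionEmbedding_star (x : F) :
    quaternionEmbedding F (star x) = star (quaternionEmbedding F x) :=
  hF.exists_embedding.choose_spec.2.1 x

theorem norm_quaternionEmbedding (x : F) : ‖quaternionEmbedding F x‖ = ‖x‖ :=
  hF.exists_embedding.choose_spec.2.2 x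

variable (F) in
/-- The embedding of `F` into the quaternions as a linear isometry. -/
def quaternionIsometry : F →ₗᵢ[ℝ] ℍ[ℝ] where
  toFun := quaternionEmbedding F
  map_add' := map_add _
  map_smul' := quaternionEmbedding_smul
  norm_map' := norm_quaternionEmbedding

theorem quaternionEmbedding_injective : Function.Injective (quaternionEmbedding F) :=
  (quaternionIsometry F).injective

/-- The assumed structures on `F` do not relate real scalars to multiplication or to the star; this
compatibility is pulled back from `ℍ` along the injective embedding. -/
instance : IsScalarTower ℝ F F where
  smul_assoc r x y := quaternionEmbedding_injective (by
    simp [quaternionEmbedding_smul])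

instance : SMulCommClass ℝ F F where
  smul_comm r x y := quaternionEmbedding_injective (by
    simp [quaternionEmbedding_smul])

instance : StarModule ℝ F where
  star_smul r x := quaternionEmbedding_injective (by
    simp [quaternionEmbedding_smul, quaternionEmbedding_star])

instance : FiniteDimensional ℝ F :=
  FiniteDimensional.of_injective (quaternionIsometry F).toLinearMap
    (quaternionIsometry F).injective

theorem inner_quaternionEmbedding (x y : F) :
    (inner ℝ (quaternionEmbedding F x) (quaternionEmbedding F y) : ℝ) = inner ℝ x y :=
  (quaternionIsometry F).inner_map_map x y

theorem re_quaternionEmbedding (x : F) : (quaternionEmbedding F x).re = rePart x := by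
  rw [rePart, ← inner_quaternionEmbedding, map_one, Quaternion.inner_def]
  simp

theorem rePart_mul_comm (x y : F) : rePart (x * y) = rePart (y * x) := by
  simp only [← re_quaternionEmbedding, map_mul]
  exact Quaternion.re_mul_comm _ _

theorem rePart_star (x : F) : rePart (star x) = rePart x := by
  simp [← re_quaternionEmbedding, quaternionEmbedding_star]

theorem inner_eq_rePart (x y : F) : (inner ℝ x y : ℝ) = rePart (x * star y) := by
  rw [← inner_quaternionEmbedding, ← re_quaternionEmbedding, map_mul, quaternionEmbedding_star,
    Quaternion.inner_def]

omit [StarRing F] hF in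
theorem rePart_add (x y : F) : rePart (x + y) = rePart x + rePart y := by
  simp [rePart, inner_add_right]

theorem rePart_one : rePart (1 : F) = 1 := by
  simp [← re_quaternionEmbedding]

theorem add_star_eq (x : F) : x + star x = (2 * rePart x) • (1 : F) := by
  apply quaternionEmbedding_injective
  rw [map_add, quaternionEmbedding_star, quaternionEmbedding_smul, map_one,
    ← re_quaternionEmbedding]
  ext <;> simp
  ring

theorem eq_smul_one_of_star_eq {x : F} (hx : star x = x) : x = rePart x • (1 : F) := by
  have h := add_star_eq x
  rw [hx, ← two_smul ℝ x, mul_smul] at h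
  exact smul_right_injective F (two_ne_zero (α := ℝ)) h

theorem norm_mul_eq (x y : F) : ‖x * y‖ = ‖x‖ * ‖y‖ := by
  rw [← norm_quaternionEmbedding, map_mul, norm_mul, norm_quaternionEmbedding,
    norm_quaternionEmbedding]

/-- Multiply `x + x̄ = 2 Re x` by `x` and take real parts. -/
theorem rePart_mul_self (x : F) : rePart (x * x) = 2 * rePart x ^ 2 - ‖x‖ ^ 2 := by
  rw [← real_inner_self_eq_norm_sq, inner_eq_rePart]
  have h : x * x + x * star x = (2 * rePart x) • x := by
    rw [← mul_add, add_star_eq, mul_smul_comm, mul_one]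
  have h2 := congrArg rePart h
  rw [rePart_add] at h2
  have h3 : rePart ((2 * rePart x) • x) = 2 * rePart x * rePart x := by
    simp [rePart, inner_smul_right]
  rw [h3] at h2
  linarith

/-- For an orthonormal basis `b` of `F`, the sum of `Re (x b̄ₖ x b̄ₖ)`. -/
theorem sum_rePart_mul_star_mul_self {m : ℕ} (b : OrthonormalBasis (Fin m) ℝ F) (x : F) :
    ∑ k, rePart (x * star (b k) * (x * star (b k))) = (2 - m) * ‖x‖ ^ 2 := by
  have hn : ∀ k, ‖star (b k)‖ = 1 := fun k => by
    rw [← norm_quaternionEmbedding, quaternionEmbedding_star, norm_star,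
      norm_quaternionEmbedding, b.norm_eq_one]
  -- Each summand is `2⟨x, bₖ⟩² - |x|²`; Parseval sums the first terms to `2|x|²`.
  have h := b.sum_sq_inner_left x
  simp only [rePart_mul_self, ← inner_eq_rePart, norm_mul_eq, hn, mul_one,
    Finset.sum_sub_distrib, ← Finset.mul_sum]
  rw [h]
  simp
  ring

end Algebras

/-! ### The Euclidean space of matrices -/

section MatrixSpace

variable {n : ℕ} {F : Type*} [NormedRing F] [StarRing F] [InnerProductSpace ℝ F]
  [hF : IsQuaternionSubalgebra F]

instance : FiniteDimensional ℝ (Matrix (Fin n) (Fin n) F) :=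
  inferInstanceAs (FiniteDimensional ℝ (Fin n → Fin n → F))

omit [StarRing F] hF in
theorem rePart_sum {ι : Type*} (s : Finset ι) (f : ι → F) :
    rePart (∑ i ∈ s, f i) = ∑ i ∈ s, rePart (f i) := by
  simp [rePart, inner_sum]

omit [StarRing F] hF in
theorem rePart_smul (r : ℝ) (x : F) : rePart (r • x) = r * rePart x := by
  simp [rePart, inner_smul_right]

omit [StarRing F] hF in
theorem matrix_inner_def (A B : Matrix (Fin n) (Fin n) F) :
    (inner ℝ A B : ℝ) = ∑ i, ∑ j, inner ℝ (A i j) (B i j) := rfl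

/-- The real part of the trace. -/
def reTrace (A : Matrix (Fin n) (Fin n) F) : ℝ := rePart A.trace

omit [StarRing F] hF in
theorem reTrace_eq_inner (A : Matrix (Fin n) (Fin n) F) : reTrace A = inner ℝ 1 A := by
  rw [reTrace, Matrix.trace, rePart_sum, matrix_inner_def]
  refine Finset.sum_congr rfl fun i _ => ?_
  rw [Finset.sum_eq_single i]
  · simp [rePart]
  · intro j _ hj
    simp [Matrix.one_apply_ne hj.symm]
  · simp

theorem inner_eq_reTrace (A B : Matrix (Fin n) (Fin n) F) :
    (inner ℝ A B : ℝ) = reTrace (A * Bᴴ) := by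
  rw [reTrace, Matrix.trace, rePart_sum, matrix_inner_def]
  simp only [Matrix.diag_apply, Matrix.mul_apply, Matrix.conjTranspose_apply, rePart_sum,
    inner_eq_rePart]

theorem reTrace_mul_comm (A B : Matrix (Fin n) (Fin n) F) :
    reTrace (A * B) = reTrace (B * A) := by
  simp only [reTrace, Matrix.trace, Matrix.diag_apply, Matrix.mul_apply, rePart_sum]
  rw [Finset.sum_comm]
  exact Finset.sum_congr rfl fun i _ => Finset.sum_congr rfl fun j _ => rePart_mul_comm _ _

theorem reTrace_conjTranspose (A : Matrix (Fin n) (Fin n) F) : reTrace Aᴴ = reTrace A := by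
  rw [reTrace, Matrix.trace_conjTranspose, rePart_star, reTrace]

theorem inner_conjTranspose (A B : Matrix (Fin n) (Fin n) F) :
    (inner ℝ Aᴴ Bᴴ : ℝ) = inner ℝ A B := by
  rw [inner_eq_reTrace, inner_eq_reTrace, Matrix.conjTranspose_conjTranspose,
    reTrace_mul_comm, ← reTrace_conjTranspose, Matrix.conjTranspose_mul,
    Matrix.conjTranspose_conjTranspose]

theorem inner_conjTranspose_left (A B : Matrix (Fin n) (Fin n) F) :
    (inner ℝ Aᴴ B : ℝ) = inner ℝ A Bᴴ := by
  rw [← inner_conjTranspose, Matrix.conjTranspose_conjTranspose]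

theorem inner_mul_left_eq (A X Y : Matrix (Fin n) (Fin n) F) :
    (inner ℝ (A * X) Y : ℝ) = inner ℝ X (Aᴴ * Y) := by
  rw [inner_eq_reTrace, inner_eq_reTrace, Matrix.conjTranspose_mul,
    Matrix.conjTranspose_conjTranspose, mul_assoc, reTrace_mul_comm, mul_assoc]

theorem inner_mul_right_eq (A X Y : Matrix (Fin n) (Fin n) F) :
    (inner ℝ (X * A) Y : ℝ) = inner ℝ X (Y * Aᴴ) := by
  rw [inner_eq_reTrace, inner_eq_reTrace, Matrix.conjTranspose_mul,
    Matrix.conjTranspose_conjTranspose, mul_assoc]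

/-- The trace of a Hermitian matrix is real. -/
theorem trace_eq_zero_iff {A : Matrix (Fin n) (Fin n) F} (hA : Aᴴ = A) :
    A.trace = 0 ↔ reTrace A = 0 := by
  have h : star A.trace = A.trace := by rw [← Matrix.trace_conjTranspose, hA]
  constructor
  · intro h0
    simp [reTrace, h0, rePart]
  · intro h0
    rw [eq_smul_one_of_star_eq h, ← reTrace, h0, zero_smul]

/-- The power sums of a Hermitian matrix are the power sums of `n` real numbers. -/
theorem exists_reTrace_pow_eq_sum {A : Matrix (Fin n) (Fin n) F} (hA : Aᴴ = A) :
    ∃ l : Fin n → ℝ, ∀ k : ℕ, reTrace (A ^ k) = ∑ i, l i ^ k := by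
  have hB : (A.map (quaternionEmbedding F))ᴴ = A.map (quaternionEmbedding F) := by
    ext1 i j
    rw [Matrix.conjTranspose_apply, Matrix.map_apply, Matrix.map_apply,
      ← quaternionEmbedding_star, ← Matrix.conjTranspose_apply, hA]
  obtain ⟨l, hl⟩ := exists_re_trace_pow_eq_sum hB
  refine ⟨l, fun k => ?_⟩
  rw [← hl, reTrace, ← re_quaternionEmbedding, ← Matrix.map_pow, AddMonoidHom.map_trace]

/-- The linear map `X ↦ B X C`. -/
def mulBoth (B C : Matrix (Fin n) (Fin n) F) :
    Matrix (Fin n) (Fin n) F →ₗ[ℝ] Matrix (Fin n) (Fin n) F where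
  toFun X := B * X * C
  map_add' X Y := by rw [mul_add, add_mul]
  map_smul' r X := by simp

/-- The linear map `X ↦ B Xᴴ C`. -/
def mulBothStar (B C : Matrix (Fin n) (Fin n) F) :
    Matrix (Fin n) (Fin n) F →ₗ[ℝ] Matrix (Fin n) (Fin n) F where
  toFun X := B * Xᴴ * C
  map_add' X Y := by rw [Matrix.conjTranspose_add, mul_add, add_mul]
  map_smul' r X := by simp [Matrix.conjTranspose_smul]

/-- The trace of an endomorphism of the space of matrices, in the basis `bₖ Eᵢⱼ`. -/
theorem trace_matrix_endomorphism
    (L : Matrix (Fin n) (Fin n) F →ₗ[ℝ] Matrix (Fin n) (Fin n) F) :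
    LinearMap.trace ℝ _ L = ∑ i, ∑ j, ∑ k, inner ℝ (stdOrthonormalBasis ℝ F k)
      (L (Matrix.single i j (stdOrthonormalBasis ℝ F k)) i j) := by
  let b := stdOrthonormalBasis ℝ F
  have hin : ∀ (i j : Fin n) (x : F) (X : Matrix (Fin n) (Fin n) F),
      (inner ℝ (Matrix.single i j x) X : ℝ) = inner ℝ x (X i j) := fun i j x X => by
    rw [matrix_inner_def, Finset.sum_eq_single i, Finset.sum_eq_single j]
    · simp
    · intro j' _ hj
      rw [Matrix.single_apply, if_neg fun h => hj h.2.symm, inner_zero_left]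
    · simp
    · intro i' _ hi
      refine Finset.sum_eq_zero fun j' _ => ?_
      rw [Matrix.single_apply, if_neg fun h => hi h.1.symm, inner_zero_left]
    · simp
  have hres : ∀ X : Matrix (Fin n) (Fin n) F, ∑ a : Fin n × Fin n × Fin (Module.finrank ℝ F),
      (inner ℝ (Matrix.single a.1 a.2.1 (b a.2.2)) X : ℝ) •
        Matrix.single a.1 a.2.1 (b a.2.2) = X := by
    intro X
    simp only [Fintype.sum_prod_type, hin]
    conv_rhs => rw [Matrix.matrix_eq_sum_single X]
    refine Finset.sum_congr rfl fun i _ => Finset.sum_congr rfl fun j _ => ?_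
    conv_rhs => rw [← b.sum_repr' (X i j)]
    rw [← Matrix.singleAddMonoidHom_apply, map_sum]
    simp [Matrix.smul_single]
  rw [trace_eq_sum_inner_of_resolution _ hres]
  simp only [Fintype.sum_prod_type, hin]
  rfl

theorem diag_eq_smul_one {A : Matrix (Fin n) (Fin n) F} (hA : Aᴴ = A) (i : Fin n) :
    A i i = rePart (A i i) • (1 : F) :=
  eq_smul_one_of_star_eq (by rw [← Matrix.conjTranspose_apply, hA])

/-- The diagonal coefficient at `bₖ Eᵢⱼ` is `⟨bₖ, Bᵢᵢ bₖ Cⱼⱼ⟩`. Hermitian matrices have real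
diagonal, so it equals `Bᵢᵢ Cⱼⱼ` for each `k`. -/
theorem trace_mulBoth {B C : Matrix (Fin n) (Fin n) F} (hB : Bᴴ = B) (hC : Cᴴ = C) :
    LinearMap.trace ℝ _ (mulBoth B C) = Module.finrank ℝ F * (reTrace B * reTrace C) := by
  have h : ∀ i j k, (inner ℝ (stdOrthonormalBasis ℝ F k)
      (mulBoth B C (Matrix.single i j (stdOrthonormalBasis ℝ F k)) i j) : ℝ) =
      rePart (B i i) * rePart (C j j) := by
    intro i j k
    have h1 : mulBoth B C (Matrix.single i j (stdOrthonormalBasis ℝ F k)) i j =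
        B i i * stdOrthonormalBasis ℝ F k * C j j := by
      change (B * Matrix.single i j (stdOrthonormalBasis ℝ F k) * C) i j = _
      rw [Matrix.mul_apply, Finset.sum_eq_single j, Matrix.mul_single_apply_same]
      · intro j' _ hj
        simp [Matrix.mul_single_apply_of_ne _ _ _ _ _ hj]
      · simp
    rw [h1, diag_eq_smul_one hB, diag_eq_smul_one hC]
    simp only [rePart_smul, rePart_one, mul_one, smul_mul_assoc, one_mul, mul_smul_comm,
      inner_smul_right, real_inner_self_eq_norm_sq, (stdOrthonormalBasis ℝ F).norm_eq_one, one_pow]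
    ring
  rw [trace_matrix_endomorphism]
  simp only [h]
  simp only [Finset.sum_const, Finset.card_univ, Fintype.card_fin, nsmul_eq_mul, reTrace,
    Matrix.trace, rePart_sum, Matrix.diag_apply]
  rw [Finset.sum_mul_sum, Finset.mul_sum]
  simp only [Finset.mul_sum]

/-- The adjoint of `bₖ Eᵢⱼ` is `b̄ₖ Eⱼᵢ`, so off-diagonal entries of `B` and `C` enter here, unlike
in `trace_mulBoth`. -/
theorem trace_mulBothStar (B C : Matrix (Fin n) (Fin n) F) :
    LinearMap.trace ℝ _ (mulBothStar B C) = ∑ i, ∑ j, ∑ k,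
      rePart (B i j * star (stdOrthonormalBasis ℝ F k) *
        (C i j * star (stdOrthonormalBasis ℝ F k))) := by
  rw [trace_matrix_endomorphism]
  refine Finset.sum_congr rfl fun i _ => Finset.sum_congr rfl fun j _ =>
    Finset.sum_congr rfl fun k _ => ?_
  have h1 : mulBothStar B C (Matrix.single i j (stdOrthonormalBasis ℝ F k)) i j =
      B i j * star (stdOrthonormalBasis ℝ F k) * C i j := by
    change (B * (Matrix.single i j (stdOrthonormalBasis ℝ F k))ᴴ * C) i j = _
    rw [Matrix.conjTranspose_single, Matrix.mul_apply, Finset.sum_eq_single i,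
      Matrix.mul_single_apply_same]
    · intro j' _ hj
      simp [Matrix.mul_single_apply_of_ne _ _ _ _ _ hj]
    · simp
  rw [h1, real_inner_comm, inner_eq_rePart, mul_assoc]

theorem trace_mulBothStar_self (A : Matrix (Fin n) (Fin n) F) :
    LinearMap.trace ℝ _ (mulBothStar A A) = (2 - Module.finrank ℝ F) * ‖A‖ ^ 2 := by
  rw [trace_mulBothStar]
  simp only [sum_rePart_mul_star_mul_self]
  rw [← real_inner_self_eq_norm_sq, matrix_inner_def, Finset.mul_sum]
  simp only [Finset.mul_sum, real_inner_self_eq_norm_sq]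

theorem trace_mulBothStar_one_right {A : Matrix (Fin n) (Fin n) F} (hA : Aᴴ = A) :
    LinearMap.trace ℝ _ (mulBothStar A 1) = (2 - Module.finrank ℝ F) * reTrace A := by
  rw [trace_mulBothStar, reTrace, Matrix.trace, rePart_sum, Finset.mul_sum]
  refine Finset.sum_congr rfl fun i _ => ?_
  rw [Finset.sum_eq_single i]
  · have h := sum_rePart_mul_star_mul_self (stdOrthonormalBasis ℝ F) (1 : F)
    have h1 : ‖(1 : F)‖ = 1 := by rw [← norm_quaternionEmbedding, map_one, norm_one]
    rw [h1, one_pow, mul_one] at h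
    rw [Matrix.diag_apply, ← h, Finset.sum_mul]
    refine Finset.sum_congr rfl fun k _ => ?_
    rw [diag_eq_smul_one hA]
    simp only [Matrix.one_apply_eq, rePart_smul, rePart_one, mul_one, smul_mul_assoc, one_mul]
    ring
  · intro j _ hj
    simp [Matrix.one_apply_ne hj.symm, rePart]
  · simp

theorem trace_mulBothStar_one_left {A : Matrix (Fin n) (Fin n) F} (hA : Aᴴ = A) :
    LinearMap.trace ℝ _ (mulBothStar 1 A) = (2 - Module.finrank ℝ F) * reTrace A := by
  rw [← trace_mulBothStar_one_right hA, trace_mulBothStar, trace_mulBothStar]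
  simp only [rePart_mul_comm]

end MatrixSpace

/-! ### Traces along the zero set of `tr A³` -/

section ZeroSet

variable {F : Type*} [NormedRing F] [StarRing F] [InnerProductSpace ℝ F]
  [hF : IsQuaternionSubalgebra F]

omit [StarRing F] hF in
theorem reTrace_add {n : ℕ} (A B : Matrix (Fin n) (Fin n) F) :
    reTrace (A + B) = reTrace A + reTrace B := by
  simp [reTrace, rePart_add]

omit [StarRing F] hF in
theorem reTrace_sub {n : ℕ} (A B : Matrix (Fin n) (Fin n) F) :
    reTrace (A - B) = reTrace A - reTrace B := by
  simp [reTrace_eq_inner, inner_sub_right]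

omit [StarRing F] hF in
theorem reTrace_smul {n : ℕ} (r : ℝ) (A : Matrix (Fin n) (Fin n) F) :
    reTrace (r • A) = r * reTrace A := by
  simp [reTrace_eq_inner, inner_smul_right]

theorem reTrace_one {n : ℕ} : reTrace (1 : Matrix (Fin n) (Fin n) F) = n := by
  rw [reTrace, Matrix.trace, rePart_sum]
  simp [rePart_one]

theorem inner_eq_reTrace_mul {n : ℕ} (A : Matrix (Fin n) (Fin n) F)
    {B : Matrix (Fin n) (Fin n) F} (hB : Bᴴ = B) : (inner ℝ A B : ℝ) = reTrace (A * B) := by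
  rw [inner_eq_reTrace, hB]

/-- The Hermitian part of a matrix. -/
def hermitianPart (F : Type*) [NormedRing F] [StarRing F] [InnerProductSpace ℝ F]
    [IsQuaternionSubalgebra F] (n : ℕ) :
    Matrix (Fin n) (Fin n) F →ₗ[ℝ] Matrix (Fin n) (Fin n) F :=
  (1 / 2 : ℝ) • (mulBoth 1 1 + mulBothStar 1 1)

theorem hermitianPart_apply {n : ℕ} (X : Matrix (Fin n) (Fin n) F) :
    hermitianPart F n X = (1 / 2 : ℝ) • (X + Xᴴ) := by
  simp [hermitianPart, mulBoth, mulBothStar]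

theorem hermitianPart_of_isHermitian {n : ℕ} {X : Matrix (Fin n) (Fin n) F} (hX : Xᴴ = X) :
    hermitianPart F n X = X := by
  rw [hermitianPart_apply, hX]
  module

theorem conjTranspose_hermitianPart {n : ℕ} (X : Matrix (Fin n) (Fin n) F) :
    (hermitianPart F n X)ᴴ = hermitianPart F n X := by
  simp [hermitianPart_apply, Matrix.conjTranspose_smul, add_comm]

theorem inner_hermitianPart {n : ℕ} (X Y : Matrix (Fin n) (Fin n) F) :
    (inner ℝ (hermitianPart F n X) Y : ℝ) = inner ℝ X (hermitianPart F n Y) := by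
  simp only [hermitianPart_apply, inner_smul_left, inner_smul_right, inner_add_left,
    inner_add_right, inner_conjTranspose_left]
  simp

/-- The linear map `X ↦ A X + X A`. -/
def anticommutator {n : ℕ} (A : Matrix (Fin n) (Fin n) F) :
    Matrix (Fin n) (Fin n) F →ₗ[ℝ] Matrix (Fin n) (Fin n) F :=
  mulBoth A 1 + mulBoth 1 A

theorem anticommutator_apply {n : ℕ} (A X : Matrix (Fin n) (Fin n) F) :
    anticommutator A X = A * X + X * A := by
  simp [anticommutator, mulBoth]

theorem inner_anticommutator {n : ℕ} {A : Matrix (Fin n) (Fin n) F} (hA : Aᴴ = A)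
    (X Y : Matrix (Fin n) (Fin n) F) :
    (inner ℝ (anticommutator A X) Y : ℝ) = inner ℝ X (anticommutator A Y) := by
  simp only [anticommutator_apply, inner_add_left, inner_add_right]
  rw [inner_mul_left_eq, inner_mul_right_eq, hA]

theorem anticommutator_hermitianPart {n : ℕ} {A : Matrix (Fin n) (Fin n) F} (hA : Aᴴ = A)
    (X : Matrix (Fin n) (Fin n) F) :
    anticommutator A (hermitianPart F n X) = hermitianPart F n (anticommutator A X) := by
  simp only [anticommutator_apply, hermitianPart_apply, Matrix.conjTranspose_add,
    Matrix.conjTranspose_mul, hA, mul_smul_comm, smul_mul_assoc, mul_add, add_mul]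
  module

/-- The trace of the projection is the real dimension `n + m n(n-1)/2` of the Hermitian matrices. -/
theorem trace_hermitianPart {n : ℕ} : LinearMap.trace ℝ _ (hermitianPart F n) =
    (1 / 2) * (Module.finrank ℝ F * n ^ 2 + (2 - Module.finrank ℝ F) * n) := by
  rw [hermitianPart, map_smul, map_add, trace_mulBoth Matrix.conjTranspose_one
    Matrix.conjTranspose_one, trace_mulBothStar_one_left Matrix.conjTranspose_one, reTrace_one,
    smul_eq_mul]
  ring

theorem trace_anticommutator_hermitianPart {n : ℕ} {A : Matrix (Fin n) (Fin n) F} (hA : Aᴴ = A) :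
    LinearMap.trace ℝ _ (anticommutator A ∘ₗ hermitianPart F n) =
      (Module.finrank ℝ F * n + 2 - Module.finrank ℝ F) * reTrace A := by
  have h : anticommutator A ∘ₗ hermitianPart F n = (1 / 2 : ℝ) •
      (mulBoth A 1 + mulBoth 1 A + mulBothStar A 1 + mulBothStar 1 A) := by
    refine LinearMap.ext fun X => ?_
    simp only [LinearMap.comp_apply, anticommutator_apply, hermitianPart_apply, mulBoth,
      mulBothStar, LinearMap.smul_apply, LinearMap.add_apply, LinearMap.coe_mk, AddHom.coe_mk,
      mul_smul_comm, smul_mul_assoc, mul_add, add_mul, mul_one, one_mul]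
    module
  rw [h]
  simp only [map_smul, map_add, trace_mulBoth hA Matrix.conjTranspose_one,
    trace_mulBoth Matrix.conjTranspose_one hA, trace_mulBothStar_one_left hA,
    trace_mulBothStar_one_right hA, reTrace_one, smul_eq_mul]
  ring

/-- In the expansion of the square, the middle terms `2AXA` and `2AXᴴA` produce `(tr A)²` and
`|A|²`; the outer ones produce `tr A²`. -/
theorem trace_anticommutator_sq_hermitianPart {n : ℕ} {A : Matrix (Fin n) (Fin n) F}
    (hA : Aᴴ = A) :
    LinearMap.trace ℝ _ (anticommutator A ∘ₗ anticommutator A ∘ₗ hermitianPart F n) =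
      (Module.finrank ℝ F * n + 2 - Module.finrank ℝ F) * reTrace (A * A) +
        Module.finrank ℝ F * reTrace A ^ 2 + (2 - Module.finrank ℝ F) * ‖A‖ ^ 2 := by
  have h : anticommutator A ∘ₗ anticommutator A ∘ₗ hermitianPart F n = (1 / 2 : ℝ) •
      (mulBoth (A * A) 1 + (2 : ℝ) • mulBoth A A + mulBoth 1 (A * A) +
        mulBothStar (A * A) 1 + (2 : ℝ) • mulBothStar A A + mulBothStar 1 (A * A)) := by
    refine LinearMap.ext fun X => ?_
    simp only [LinearMap.comp_apply, anticommutator_apply, hermitianPart_apply, mulBoth,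
      mulBothStar, LinearMap.smul_apply, LinearMap.add_apply, LinearMap.coe_mk, AddHom.coe_mk,
      mul_smul_comm, smul_mul_assoc, mul_add, add_mul, mul_one, one_mul, mul_assoc]
    module
  have hAA : (A * A)ᴴ = A * A := by rw [Matrix.conjTranspose_mul, hA]
  rw [h]
  simp only [map_smul, map_add, trace_mulBoth hAA Matrix.conjTranspose_one,
    trace_mulBoth Matrix.conjTranspose_one hAA, trace_mulBoth hA hA,
    trace_mulBothStar_one_left hAA, trace_mulBothStar_one_right hAA, trace_mulBothStar_self,
    reTrace_one, smul_eq_mul]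
  ring

/-- The traceless part `A² - 1/4` of the square of a matrix with `tr A² = 1`. -/
def squareTraceless (A : Matrix (Fin 4) (Fin 4) F) : Matrix (Fin 4) (Fin 4) F :=
  A * A - (1 / 4 : ℝ) • 1

/-- `A` is a point of `S(4, F)` with `tr A³ = 0` and `A² ≠ 1/4`. -/
structure IsRegularZero (A : Matrix (Fin 4) (Fin 4) F) : Prop where
  conjTranspose_eq : Aᴴ = A
  reTrace_eq : reTrace A = 0
  norm_eq : ‖A‖ = 1
  reTrace_cube : reTrace (A * A * A) = 0
  squareTraceless_ne : squareTraceless A ≠ 0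

theorem conjTranspose_squareTraceless {A : Matrix (Fin 4) (Fin 4) F} (hA : Aᴴ = A) :
    (squareTraceless A)ᴴ = squareTraceless A := by
  simp [squareTraceless, Matrix.conjTranspose_smul, hA]

/-- An orthonormal basis of the normal space at `A`. -/
def normalVectors (A : Matrix (Fin 4) (Fin 4) F) : Fin 3 → Matrix (Fin 4) (Fin 4) F :=
  ![(1 / 2 : ℝ) • 1, A, ‖squareTraceless A‖⁻¹ • squareTraceless A]

namespace IsRegularZero

variable {A : Matrix (Fin 4) (Fin 4) F} (h : IsRegularZero A)
include h

theorem reTrace_sq : reTrace (A * A) = 1 := by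
  rw [← inner_eq_reTrace_mul A h.conjTranspose_eq, real_inner_self_eq_norm_sq, h.norm_eq, one_pow]

omit [StarRing F] hF h in
theorem inner_squareTraceless (X : Matrix (Fin 4) (Fin 4) F) :
    (inner ℝ (squareTraceless A) X : ℝ) = inner ℝ (A * A) X - 1 / 4 * inner ℝ 1 X := by
  rw [squareTraceless, inner_sub_left, real_inner_smul_left]

/-- With `L` the anticommutator with `A`, `tr A⁵` enters `⟨L N, N⟩` and `tr A⁶` enters `|L N|²`. -/
theorem reTrace_five_six : reTrace (A ^ 5) = 0 ∧
    reTrace (A ^ 6) = 3 / 4 * reTrace (A ^ 4) - 1 / 8 := by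
  obtain ⟨l, hl⟩ := exists_reTrace_pow_eq_sum h.conjTranspose_eq
  have := power_sums_of_odd_eq_zero l (by rw [← hl, pow_one, h.reTrace_eq])
    (by rw [← hl, sq, h.reTrace_sq]) (by rw [← hl, pow_succ, sq, h.reTrace_cube])
  simpa only [hl] using this

theorem norm_squareTraceless_sq : ‖squareTraceless A‖ ^ 2 = reTrace (A ^ 4) - 1 / 4 := by
  have h1 : squareTraceless A * squareTraceless A =
      A ^ 4 - (1 / 2 : ℝ) • (A * A) + (1 / 16 : ℝ) • 1 := by
    simp only [squareTraceless, sub_mul, mul_sub, mul_smul_comm, smul_mul_assoc, mul_one, one_mul,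
      pow_succ, pow_zero, mul_assoc]
    module
  rw [← real_inner_self_eq_norm_sq,
    inner_eq_reTrace_mul _ (conjTranspose_squareTraceless h.conjTranspose_eq), h1, reTrace_add,
    reTrace_sub, reTrace_smul, reTrace_smul, h.reTrace_sq, reTrace_one]
  norm_num
  ring

omit hF in
theorem norm_squareTraceless_ne : ‖squareTraceless A‖ ≠ 0 :=
  norm_ne_zero_iff.2 h.squareTraceless_ne

omit hF in
theorem inner_one_self : (inner ℝ 1 A : ℝ) = 0 := by
  rw [← reTrace_eq_inner, h.reTrace_eq]

theorem inner_one_squareTraceless : (inner ℝ 1 (squareTraceless A) : ℝ) = 0 := by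
  rw [← reTrace_eq_inner, squareTraceless, reTrace_sub, reTrace_smul, h.reTrace_sq, reTrace_one]
  norm_num

theorem inner_self_squareTraceless : (inner ℝ A (squareTraceless A) : ℝ) = 0 := by
  rw [real_inner_comm, inner_squareTraceless, h.inner_one_self,
    inner_eq_reTrace_mul _ h.conjTranspose_eq, h.reTrace_cube]
  ring

theorem conjTranspose_normalVectors (a : Fin 3) : (normalVectors A a)ᴴ = normalVectors A a := by
  fin_cases a
  · simp [normalVectors, Matrix.conjTranspose_smul]
  · exact h.conjTranspose_eq
  · simp [normalVectors, Matrix.conjTranspose_smul,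
      conjTranspose_squareTraceless h.conjTranspose_eq]

theorem inner_normalVectors (a b : Fin 3) :
    (inner ℝ (normalVectors A a) (normalVectors A b) : ℝ) = if a = b then 1 else 0 := by
  have h1 : (inner ℝ (1 : Matrix (Fin 4) (Fin 4) F) 1 : ℝ) = 4 := by
    rw [← reTrace_eq_inner, reTrace_one]; norm_num
  have hr := h.norm_squareTraceless_ne
  have h2 := h.inner_one_self
  have h3 := h.inner_one_squareTraceless
  have h4 := h.inner_self_squareTraceless
  have h5 := real_inner_comm 1 A
  have h6 := real_inner_comm 1 (squareTraceless A)
  have h7 := real_inner_comm A (squareTraceless A)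
  have h8 : (inner ℝ A A : ℝ) = 1 := by rw [real_inner_self_eq_norm_sq, h.norm_eq, one_pow]
  have h9 := real_inner_self_eq_norm_sq (squareTraceless A)
  have h10 : ‖squareTraceless A‖⁻¹ * (‖squareTraceless A‖⁻¹ * ‖squareTraceless A‖ ^ 2) = 1 := by
    field_simp
  fin_cases a <;> fin_cases b <;>
    simp [normalVectors, -inner_self_eq_norm_sq_to_K, real_inner_smul_left, real_inner_smul_right,
      h1, h2, h3, h4, h5, h6, h7, h8, h9, h10]
  norm_num

omit h in
theorem anticommutator_normalVectors :
    (fun a => anticommutator A (normalVectors A a)) =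
      ![A, (2 : ℝ) • (A * A), (2 * ‖squareTraceless A‖⁻¹) • (A ^ 3 - (1 / 4 : ℝ) • A)] := by
  funext a
  fin_cases a
  · simp [normalVectors, anticommutator_apply]
    module
  · simp [normalVectors, anticommutator_apply]
    module
  · simp [normalVectors, anticommutator_apply, squareTraceless, mul_sub, sub_mul, pow_succ,
      mul_assoc]
    module

theorem trace_removeDirections_eq :
    LinearMap.trace ℝ _ (removeDirections (hermitianPart F 4) (normalVectors A)) =
      6 * Module.finrank ℝ F + 1 := by
  rw [trace_removeDirections, trace_hermitianPart]
  simp [h.inner_normalVectors, -inner_self_eq_norm_sq_to_K]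
  ring

/-- With `ν` the normal basis, `L ν₀ = ν₁` and `L ν₁ = 2A² = ν₀ + 2|N| ν₂`. The image `L ν₂` may
leave the normal space; its `ν₂`-component vanishes because the odd traces, `tr A⁵` included, do. -/
theorem inner_anticommutator_normalVectors (a b : Fin 3) :
    (inner ℝ (anticommutator A (normalVectors A a)) (normalVectors A b) : ℝ) =
      !![0, 1, 0; 1, 0, 2 * ‖squareTraceless A‖; 0, 2 * ‖squareTraceless A‖, 0] a b := by
  have hr := h.norm_squareTraceless_ne
  have hr2 : reTrace (A ^ 4) = ‖squareTraceless A‖ ^ 2 + 1 / 4 := by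
    rw [h.norm_squareTraceless_sq]; ring
  have e := congrFun (anticommutator_normalVectors (A := A)) a
  have h1 := h.reTrace_eq
  have h2 := h.reTrace_sq
  have h3 := h.reTrace_cube
  have h5 := h.reTrace_five_six.1
  simp only [pow_succ, pow_zero, one_mul, mul_assoc] at h3 hr2 h5
  rw [inner_eq_reTrace_mul _ (h.conjTranspose_normalVectors b), show
    anticommutator A (normalVectors A a) = _ from e]
  fin_cases a <;> fin_cases b <;>
    simp [normalVectors, squareTraceless, mul_sub, sub_mul, pow_succ, mul_assoc, reTrace_sub,
      reTrace_smul, h1, h2, h3, hr2, h5, smul_sub]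
  all_goals simp only [squareTraceless] at hr
  all_goals field_simp
  all_goals norm_num

/-- The three terms are `1`, `4 tr A⁴` and `1`. The last uses `|A³ - A/4|² = |N|²/4`, which is the
relation for `tr A⁶`. -/
theorem sum_norm_anticommutator_normalVectors :
    ∑ a, (inner ℝ (anticommutator A (normalVectors A a))
      (anticommutator A (normalVectors A a)) : ℝ) = 2 + 4 * reTrace (A ^ 4) := by
  have hr := h.norm_squareTraceless_ne
  have hr2 : reTrace (A ^ 4) = ‖squareTraceless A‖ ^ 2 + 1 / 4 := by
    rw [h.norm_squareTraceless_sq]; ring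
  have h2 := h.reTrace_sq
  have h6 := h.reTrace_five_six.2
  have hA := h.conjTranspose_eq
  have e : ∀ a, anticommutator A (normalVectors A a) = _ :=
    congrFun anticommutator_normalVectors
  have hcube : (A ^ 3 - (1 / 4 : ℝ) • A)ᴴ = A ^ 3 - (1 / 4 : ℝ) • A := by
    simp [Matrix.conjTranspose_smul, hA]
  have hsq : (A * A)ᴴ = A * A := by rw [Matrix.conjTranspose_mul, hA]
  simp only [e, Fin.sum_univ_three]
  have e1 : (inner ℝ A A : ℝ) = 1 := by rw [inner_eq_reTrace_mul _ hA, h2]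
  have e2 : (inner ℝ (A * A) (A * A) : ℝ) = reTrace (A ^ 4) := by
    rw [inner_eq_reTrace_mul _ hsq]
    simp only [pow_succ, pow_zero, one_mul, mul_assoc]
  have e3 : (inner ℝ (A ^ 3 - (1 / 4 : ℝ) • A) (A ^ 3 - (1 / 4 : ℝ) • A) : ℝ) =
      ‖squareTraceless A‖ ^ 2 / 4 := by
    have : (A ^ 3 - (1 / 4 : ℝ) • A) * (A ^ 3 - (1 / 4 : ℝ) • A) =
        A ^ 6 - (1 / 2 : ℝ) • A ^ 4 + (1 / 16 : ℝ) • (A * A) := by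
      simp only [sub_mul, mul_sub, mul_smul_comm, smul_mul_assoc, one_mul,
        pow_succ, pow_zero, mul_assoc]
      module
    rw [inner_eq_reTrace_mul _ hcube, this, reTrace_add, reTrace_sub, reTrace_smul, reTrace_smul,
      h6, h2, hr2]
    ring
  generalize A ^ 3 - (1 / 4 : ℝ) • A = C at e3 ⊢
  simp [-inner_self_eq_norm_sq_to_K, real_inner_smul_left,
    real_inner_smul_right, e1, e2, e3]
  field_simp
  ring

/-- The full trace is a multiple of `tr A = 0`, and the diagonal `⟨L νₐ, νₐ⟩` is zero.
Geometrically, the regular part is minimal in the sphere. -/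
theorem trace_anticommutator_removeDirections :
    LinearMap.trace ℝ _
      (anticommutator A ∘ₗ removeDirections (hermitianPart F 4) (normalVectors A)) = 0 := by
  rw [trace_comp_removeDirections, trace_anticommutator_hermitianPart h.conjTranspose_eq,
    h.reTrace_eq]
  simp only [real_inner_comm (anticommutator A _), h.inner_anticommutator_normalVectors]
  simp [Fin.sum_univ_three]

/-- The three contributions are `2m + 4`, `-2(2 + 4 tr A⁴)` and `2(1 + 4|N|²) = 8 tr A⁴`; the
dependence on `A` cancels. -/
theorem trace_anticommutator_removeDirections_sq :
    LinearMap.trace ℝ _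
      (anticommutator A ∘ₗ removeDirections (hermitianPart F 4) (normalVectors A) ∘ₗ
        anticommutator A ∘ₗ removeDirections (hermitianPart F 4) (normalVectors A)) =
      2 * Module.finrank ℝ F := by
  rw [trace_comp_removeDirections_sq inner_hermitianPart
    (fun X => hermitianPart_of_isHermitian (conjTranspose_hermitianPart X))
    (inner_anticommutator h.conjTranspose_eq) (anticommutator_hermitianPart h.conjTranspose_eq)
    (fun a => hermitianPart_of_isHermitian (h.conjTranspose_normalVectors a)),
    trace_anticommutator_sq_hermitianPart h.conjTranspose_eq, h.reTrace_eq, h.reTrace_sq,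
    h.norm_eq, h.sum_norm_anticommutator_normalVectors]
  simp only [h.inner_anticommutator_normalVectors]
  have hr2 := h.norm_squareTraceless_sq
  simp [Fin.sum_univ_three, mul_pow, hr2]
  ring

end IsRegularZero

end ZeroSet

/-! ### The zero set of `tr A³` as a submanifold -/

section AbstractDerivatives

variable {E : Type*} [NormedAddCommGroup E] [InnerProductSpace ℝ E]

theorem hasFDerivAt_inner_cube (B : E →L[ℝ] E →L[ℝ] E) {e A G : E}
    (hG : ∀ H, (inner ℝ e (B (B A A) H + B (B A H + B H A) A) : ℝ) = 3 * inner ℝ G H) :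
    HasFDerivAt (fun X => (inner ℝ e (B (B X X) X) : ℝ)) ((3 : ℝ) • innerSL ℝ G) A := by
  have h1 := B.hasFDerivAt_of_bilinear (hasFDerivAt_id A) (hasFDerivAt_id A)
  have h2 := B.hasFDerivAt_of_bilinear h1 (hasFDerivAt_id A)
  refine ((innerSL ℝ e).hasFDerivAt.comp A h2).congr_fderiv (ContinuousLinearMap.ext fun H => ?_)
  simpa [inner_add_right] using hG H

theorem fderiv_pi_apply_eq {k : ℕ} {f : E → Fin k → ℝ} {A X : E} {g : Fin k → E →L[ℝ] ℝ}
    (h : ∀ i, HasFDerivAt (fun Y => f Y i) (g i) A) (i : Fin k) : fderiv ℝ f A X i = g i X := by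
  rw [(hasFDerivAt_pi.2 h).fderiv]
  rfl

/-- A map straightening the intersection of the unit sphere with a level set of `f`. -/
def straighten (f : E → ℝ) (A N X : E) : E :=
  X + (‖X‖ ^ 2 - 1 - inner ℝ A X) • A + (f X - inner ℝ N X / ‖N‖ ^ 2) • N

theorem contDiff_straighten {f : E → ℝ} (hf : ContDiff ℝ ∞ f) (A N : E) :
    ContDiff ℝ ∞ (straighten f A N) :=
  (contDiff_id.add ((((contDiff_norm_sq ℝ).sub contDiff_const).sub
    (contDiff_const.inner ℝ contDiff_id)).smul contDiff_const)).add
    ((hf.sub ((contDiff_const.inner ℝ contDiff_id).div_const _)).smul contDiff_const)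

/-- For `H` in the kernel, pairing with `A` gives `2⟨A, H⟩ = 0` and pairing with `N` gives `3|N|²⟨G,
H⟩ = 0`. Then `H` is a multiple of `N`, and pairing with `G` shows that the multiple is zero. -/
theorem injective_fderiv_straighten {f : E → ℝ} {A N G : E}
    (hf : HasFDerivAt f ((3 : ℝ) • innerSL ℝ G) A) (hA : ‖A‖ = 1) (hAN : (inner ℝ A N : ℝ) = 0)
    (hN : ‖N‖ ≠ 0) (hGN : (inner ℝ G N : ℝ) = ‖N‖ ^ 2) :
    Function.Injective (fderiv ℝ (straighten f A N) A) := by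
  have hd : HasFDerivAt (straighten f A N) (ContinuousLinearMap.id ℝ E +
      ((2 : ℝ) • innerSL ℝ A - innerSL ℝ A).smulRight A +
      ((3 : ℝ) • innerSL ℝ G - (‖N‖ ^ 2)⁻¹ • innerSL ℝ N).smulRight N) A := by
    have h1 : HasFDerivAt (fun X : E => ‖X‖ ^ 2 - 1) ((2 : ℝ) • innerSL ℝ A) A := by
      rw [← Nat.cast_two (R := ℝ), Nat.cast_smul_eq_nsmul]
      exact ((hasStrictFDerivAt_norm_sq A).hasFDerivAt).sub_const 1
    have h2 : HasFDerivAt (fun X : E => (inner ℝ N X : ℝ) / ‖N‖ ^ 2)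
        ((‖N‖ ^ 2)⁻¹ • innerSL ℝ N) A := by
      simpa [div_eq_inv_mul] using (innerSL ℝ N).hasFDerivAt.const_mul (‖N‖ ^ 2)⁻¹
    exact ((hasFDerivAt_id A).add ((h1.sub (innerSL ℝ A).hasFDerivAt).smul_const A)).add
      ((hf.sub h2).smul_const N)
  rw [hd.fderiv]
  refine (injective_iff_map_eq_zero _).2 fun H hH => ?_
  have e : H + (2 * inner ℝ A H - inner ℝ A H) • A +
      (3 * inner ℝ G H - (‖N‖ ^ 2)⁻¹ * inner ℝ N H) • N = 0 := by
    simpa using hH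
  have hAA : (inner ℝ A A : ℝ) = 1 := by rw [real_inner_self_eq_norm_sq, hA, one_pow]
  have hNN : (inner ℝ N N : ℝ) = ‖N‖ ^ 2 := real_inner_self_eq_norm_sq N
  have hNA : (inner ℝ N A : ℝ) = 0 := by rw [real_inner_comm]; exact hAN
  have e1 := congrArg (fun X => (inner ℝ A X : ℝ)) e
  have e2 := congrArg (fun X => (inner ℝ N X : ℝ)) e
  simp only [inner_add_right, inner_smul_right, hAA, hNN, hAN, hNA, inner_zero_right] at e1 e2
  have hAH : (inner ℝ A H : ℝ) = 0 := by linarith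
  have hGH : (inner ℝ G H : ℝ) = 0 := by
    field_simp at e2
    have : ‖N‖ ^ 2 * (inner ℝ G H : ℝ) = 0 := by linarith
    exact (mul_eq_zero.1 this).resolve_left (pow_ne_zero _ hN)
  rw [hAH, hGH] at e
  have e3 := congrArg (fun X => (inner ℝ G X : ℝ)) e
  simp only [inner_add_right, inner_smul_right, hGH, hGN, inner_zero_right] at e3
  have hNH : (inner ℝ N H : ℝ) = 0 := by
    field_simp at e3
    linarith
  rw [hNH] at e
  simpa using e

end AbstractDerivatives

/-! ### Regular points, the tangent space and charts of the regular part -/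

section Submanifold

variable {F : Type*} [NormedRing F] [StarRing F] [InnerProductSpace ℝ F]
  [hF : IsQuaternionSubalgebra F]

/-- Matrix multiplication as a continuous bilinear map. -/
def matrixMulCLM (F : Type*) [NormedRing F] [StarRing F] [InnerProductSpace ℝ F]
    [IsQuaternionSubalgebra F] (n : ℕ) : Matrix (Fin n) (Fin n) F →L[ℝ]
      Matrix (Fin n) (Fin n) F →L[ℝ] Matrix (Fin n) (Fin n) F :=
  (LinearMap.mul ℝ (Matrix (Fin n) (Fin n) F)).toContinuousBilinearMap

/-- The continuous linear map `X ↦ X - Xᴴ`. -/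
def hermitianDefectCLM (F : Type*) [NormedRing F] [StarRing F] [InnerProductSpace ℝ F]
    [IsQuaternionSubalgebra F] (n : ℕ) : Matrix (Fin n) (Fin n) F →L[ℝ]
      Matrix (Fin n) (Fin n) F :=
  LinearMap.toContinuousLinearMap (LinearMap.id - mulBothStar 1 1)

theorem hermitianDefectCLM_eq_zero_iff {n : ℕ} (X : Matrix (Fin n) (Fin n) F) :
    hermitianDefectCLM F n X = 0 ↔ Xᴴ = X := by
  simp [hermitianDefectCLM, mulBothStar, sub_eq_zero, eq_comm]

theorem contDiff_matrix_mul {n : ℕ} : ContDiff ℝ ∞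
    fun p : Matrix (Fin n) (Fin n) F × Matrix (Fin n) (Fin n) F => p.1 * p.2 :=
  (matrixMulCLM F n).isBoundedBilinearMap.contDiff

theorem contDiff_mul_self {n : ℕ} :
    ContDiff ℝ ∞ fun X : Matrix (Fin n) (Fin n) F => X * X :=
  contDiff_matrix_mul.comp (contDiff_id.prodMk contDiff_id)

theorem contDiff_reTrace_cube {n : ℕ} :
    ContDiff ℝ ∞ fun X : Matrix (Fin n) (Fin n) F => reTrace (X * X * X) := by
  simp only [reTrace_eq_inner]
  exact contDiff_const.inner ℝ (contDiff_matrix_mul.comp (contDiff_mul_self.prodMk contDiff_id))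

theorem hasFDerivAt_reTrace_cube {n : ℕ} {A : Matrix (Fin n) (Fin n) F} (hA : Aᴴ = A) :
    HasFDerivAt (fun X : Matrix (Fin n) (Fin n) F => reTrace (X * X * X))
      ((3 : ℝ) • innerSL ℝ (A * A)) A := by
  have hAA : (A * A)ᴴ = A * A := by rw [Matrix.conjTranspose_mul, hA]
  have h := hasFDerivAt_inner_cube (matrixMulCLM F n) (e := 1) (A := A) (G := A * A) fun H => by
    change (inner ℝ 1 (A * A * H + (A * H + H * A) * A) : ℝ) = _
    rw [← reTrace_eq_inner, real_inner_comm, inner_eq_reTrace_mul _ hAA, reTrace_add, add_mul,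
      reTrace_add, reTrace_mul_comm (A * A), mul_assoc A, reTrace_mul_comm A, mul_assoc H]
    ring
  simp only [reTrace_eq_inner]
  exact h

omit [StarRing F] hF in
theorem tracePow_eq_reTrace {n : ℕ} (k : ℕ) (A : Matrix (Fin n) (Fin n) F) :
    tracePow k A = reTrace (A ^ k) := rfl

omit [StarRing F] hF in
theorem oddTraces_four_apply (A : Matrix (Fin 4) (Fin 4) F) (i : Fin ((4 - 1) / 2)) :
    oddTraces 4 F A i = reTrace (A * A * A) := by
  -- For `n = 4` there is a single component, as `(4 - 1) / 2 = 1`.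
  have hi : (i : ℕ) = 0 := by have := i.2; omega
  rw [oddTraces, hi, tracePow_eq_reTrace]
  simp [pow_succ]

theorem fderiv_oddTraces_apply {A : Matrix (Fin 4) (Fin 4) F} (hA : Aᴴ = A)
    (X : Matrix (Fin 4) (Fin 4) F) (i : Fin ((4 - 1) / 2)) :
    fderiv ℝ (oddTraces 4 F) A X i = 3 * inner ℝ (A * A) X := by
  have h : ∀ i, HasFDerivAt (fun Y : Matrix (Fin 4) (Fin 4) F => oddTraces 4 F Y i)
      ((3 : ℝ) • innerSL ℝ (A * A)) A := fun i => by
    simp only [oddTraces_four_apply]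
    exact hasFDerivAt_reTrace_cube hA
  exact fderiv_pi_apply_eq h i

omit [StarRing F] hF in
theorem oddTraces_eq_zero_iff {A : Matrix (Fin 4) (Fin 4) F} :
    oddTraces 4 F A = 0 ↔ reTrace (A * A * A) = 0 := by
  rw [funext_iff]
  simp only [oddTraces_four_apply]
  exact ⟨fun h => h ⟨0, by norm_num⟩, fun h _ => h⟩

theorem mem_oddTraceZeros_iff {A : Matrix (Fin 4) (Fin 4) F} : A ∈ oddTraceZeros 4 F ↔
    Aᴴ = A ∧ reTrace A = 0 ∧ ‖A‖ = 1 ∧ reTrace (A * A * A) = 0 := by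
  constructor
  · rintro ⟨⟨⟨h1, h2⟩, h3⟩, h4⟩
    exact ⟨h1, (trace_eq_zero_iff h1).1 h2, h3, oddTraces_eq_zero_iff.1 h4⟩
  · rintro ⟨h1, h2, h3, h4⟩
    exact ⟨⟨⟨h1, (trace_eq_zero_iff h1).2 h2⟩, h3⟩, oddTraces_eq_zero_iff.2 h4⟩

/-- On traceless `X` the differential is `3⟨A², X⟩ = 3⟨N, X⟩`. It vanishes if `N = 0`; otherwise
multiples of `N`, which is tangent to the sphere, reach every value. -/
theorem isRegularPoint_iff {A : Matrix (Fin 4) (Fin 4) F} (h : A ∈ oddTraceZeros 4 F) :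
    IsRegularPoint 4 F A ↔ squareTraceless A ≠ 0 := by
  obtain ⟨h1, h2, h3, h4⟩ := mem_oddTraceZeros_iff.1 h
  have hd := fderiv_oddTraces_apply h1
  constructor
  · intro hreg h0
    obtain ⟨X, ⟨hX1, hX2⟩, -, hX⟩ := hreg 1
    have := hd X ⟨0, by norm_num⟩
    rw [hX] at this
    have hX0 := (trace_eq_zero_iff hX1).1 hX2
    rw [reTrace_eq_inner] at hX0
    have e := IsRegularZero.inner_squareTraceless (A := A) X
    rw [h0, inner_zero_left, hX0] at e
    have e2 : (inner ℝ (A * A) X : ℝ) = 0 := by linarith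
    rw [e2] at this
    norm_num at this
  · intro h0 y
    have hz : IsRegularZero A := ⟨h1, h2, h3, h4, h0⟩
    have hN := hz.norm_squareTraceless_ne
    have hNh := conjTranspose_squareTraceless h1
    refine ⟨(y ⟨0, by norm_num⟩ / (3 * ‖squareTraceless A‖ ^ 2)) • squareTraceless A,
      ⟨?_, ?_⟩, ?_, ?_⟩
    · rw [Matrix.conjTranspose_smul, hNh, star_trivial]
    · rw [Matrix.trace_smul, (trace_eq_zero_iff hNh).2, smul_zero]
      rw [reTrace_eq_inner, hz.inner_one_squareTraceless]
    · rw [inner_smul_right, hz.inner_self_squareTraceless, mul_zero]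
    · funext i
      have hi : i = ⟨0, by norm_num⟩ := Fin.ext (by have := i.2; simp)
      have e := IsRegularZero.inner_squareTraceless (A := A) (squareTraceless A)
      rw [hz.inner_one_squareTraceless, real_inner_self_eq_norm_sq] at e
      rw [hd, inner_smul_right, show (inner ℝ (A * A) (squareTraceless A) : ℝ) =
        ‖squareTraceless A‖ ^ 2 by linarith, hi]
      field_simp

theorem mem_regularPart_iff {A : Matrix (Fin 4) (Fin 4) F} :
    A ∈ regularPart 4 F ↔ IsRegularZero A := by
  constructor
  · rintro ⟨h1, h2⟩
    have h3 := (isRegularPoint_iff h1).1 h2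
    obtain ⟨a, b, c, d⟩ := mem_oddTraceZeros_iff.1 h1
    exact ⟨a, b, c, d, h3⟩
  · intro h
    have h1 := mem_oddTraceZeros_iff.2
      ⟨h.conjTranspose_eq, h.reTrace_eq, h.norm_eq, h.reTrace_cube⟩
    exact ⟨h1, (isRegularPoint_iff h1).2 h.squareTraceless_ne⟩

/-- The tangent space at `A`: the Hermitian matrices orthogonal to the normal vectors. -/
def zeroSetTangent (A : Matrix (Fin 4) (Fin 4) F) : Submodule ℝ (Matrix (Fin 4) (Fin 4) F) where
  carrier := {X | Xᴴ = X ∧ ∀ a, inner ℝ (normalVectors A a) X = (0 : ℝ)}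
  add_mem' := fun {X Y} hX hY => ⟨by rw [Matrix.conjTranspose_add, hX.1, hY.1],
    fun a => by rw [inner_add_right, hX.2, hY.2, add_zero]⟩
  zero_mem' := by simp
  smul_mem' := fun r X hX => ⟨by rw [Matrix.conjTranspose_smul, hX.1, star_trivial],
    fun a => by rw [inner_smul_right, hX.2, mul_zero]⟩

theorem mem_zeroSetTangent_iff {A X : Matrix (Fin 4) (Fin 4) F} (h : squareTraceless A ≠ 0) :
    X ∈ zeroSetTangent A ↔ Xᴴ = X ∧ inner ℝ 1 X = (0 : ℝ) ∧ inner ℝ A X = (0 : ℝ) ∧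
      inner ℝ (squareTraceless A) X = (0 : ℝ) := by
  change (_ ∧ _) ↔ _
  have : ‖squareTraceless A‖ ≠ 0 := norm_ne_zero_iff.2 h
  simp [Fin.forall_fin_succ, normalVectors, real_inner_smul_left, this]

/-- The orthogonal projection onto the tangent space. -/
def tangentProjection (A : Matrix (Fin 4) (Fin 4) F) :
    Matrix (Fin 4) (Fin 4) F →ₗ[ℝ] Matrix (Fin 4) (Fin 4) F :=
  removeDirections (hermitianPart F 4) (normalVectors A)

theorem tangentProjection_of_mem {A X : Matrix (Fin 4) (Fin 4) F} (hX : X ∈ zeroSetTangent A) :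
    tangentProjection A X = X := by
  rw [tangentProjection, removeDirections_apply, hermitianPart_of_isHermitian hX.1]
  simp [hX.2]

namespace IsRegularZero

variable {A : Matrix (Fin 4) (Fin 4) F} (h : IsRegularZero A)
include h

theorem tangentProjection_mem (X : Matrix (Fin 4) (Fin 4) F) :
    tangentProjection A X ∈ zeroSetTangent A := by
  rw [tangentProjection, removeDirections_apply]
  constructor
  · rw [Matrix.conjTranspose_sub, conjTranspose_hermitianPart, Matrix.conjTranspose_sum]
    simp [Matrix.conjTranspose_smul, h.conjTranspose_normalVectors]
  · intro a
    rw [inner_sub_right, ← inner_hermitianPart,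
      hermitianPart_of_isHermitian (h.conjTranspose_normalVectors a), inner_sum]
    simp [inner_smul_right, h.inner_normalVectors]

omit h in
theorem inner_tangentProjection (X Y : Matrix (Fin 4) (Fin 4) F) :
    (inner ℝ (tangentProjection A X) Y : ℝ) = inner ℝ X (tangentProjection A Y) := by
  simp only [tangentProjection, removeDirections_apply, inner_sub_left, inner_sub_right,
    inner_hermitianPart, sum_inner, inner_sum, real_inner_smul_left, real_inner_smul_right]
  congr 1
  refine Finset.sum_congr rfl fun a _ => ?_
  rw [real_inner_comm X]
  ring

/-- The rank of a projection is its trace. -/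
theorem finrank_zeroSetTangent :
    Module.finrank ℝ (zeroSetTangent A) = 6 * Module.finrank ℝ F + 1 := by
  have hp : LinearMap.IsProj (zeroSetTangent A) (tangentProjection A) :=
    ⟨h.tangentProjection_mem, fun X hX => tangentProjection_of_mem hX⟩
  have h1 := hp.trace
  rw [tangentProjection, h.trace_removeDirections_eq] at h1
  exact_mod_cast h1.symm

/-- The map `straighten` alters `X` only by multiples of the Hermitian `A` and `N`. It preserves the
Hermitian and trace conditions and turns the `A`- and `N`-pairings into `|X|² - 1` and `|N|² tr X³`,
so the preimage of the tangent space is the zero set. -/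
theorem exists_isLocalParametrization_regularPart :
    ∃ (U : Set (Fin (6 * Module.finrank ℝ F + 1) → ℝ)) (φ : _ → Matrix (Fin 4) (Fin 4) F),
      IsLocalParametrization (regularPart 4 F) U φ ∧ ∃ u ∈ U, φ u = A := by
  set N := squareTraceless A with hN
  have hr : ‖N‖ ≠ 0 := h.norm_squareTraceless_ne
  let Ψ : Matrix (Fin 4) (Fin 4) F → Matrix (Fin 4) (Fin 4) F :=
    straighten (fun X => reTrace (X * X * X)) A N
  have hAA : (inner ℝ A A : ℝ) = 1 := by rw [real_inner_self_eq_norm_sq, h.norm_eq, one_pow]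
  have hNN : (inner ℝ N N : ℝ) = ‖N‖ ^ 2 := real_inner_self_eq_norm_sq N
  have hAN : (inner ℝ A N : ℝ) = 0 := h.inner_self_squareTraceless
  have hNA : (inner ℝ N A : ℝ) = 0 := by rw [real_inner_comm]; exact hAN
  have h1A := h.inner_one_self
  have h1N : (inner ℝ 1 N : ℝ) = 0 := h.inner_one_squareTraceless
  have hNh : Nᴴ = N := conjTranspose_squareTraceless h.conjTranspose_eq
  refine exists_isLocalParametrization (V := {X | squareTraceless X ≠ 0}) ?_ h.squareTraceless_ne
    (mem_regularPart_iff.2 h)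
    (contDiff_straighten contDiff_reTrace_cube A N) ?_ (zeroSetTangent A) h.finrank_zeroSetTangent ?_
  · exact isOpen_ne.preimage (contDiff_mul_self.continuous.sub continuous_const)
  · refine injective_fderiv_straighten (hasFDerivAt_reTrace_cube h.conjTranspose_eq) h.norm_eq hAN
      hr ?_
    rw [← hNN, hN, inner_squareTraceless, ← hN, h1N]
    ring
  · intro X hX
    have hNX : (inner ℝ N (Ψ X) : ℝ) = ‖N‖ ^ 2 * reTrace (X * X * X) := by
      simp only [Ψ, straighten, inner_add_right, inner_smul_right, hNN, hNA]
      field_simp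
      ring
    have hAX : (inner ℝ A (Ψ X) : ℝ) = ‖X‖ ^ 2 - 1 := by
      simp only [Ψ, straighten, inner_add_right, inner_smul_right, hAA, hAN]
      ring
    have h1X : (inner ℝ 1 (Ψ X) : ℝ) = reTrace X := by
      simp only [Ψ, straighten, inner_add_right, inner_smul_right, h1A, h1N, reTrace_eq_inner]
      ring
    have hXh : (Ψ X)ᴴ = Ψ X ↔ Xᴴ = X := by
      simp only [Ψ, straighten, Matrix.conjTranspose_add, Matrix.conjTranspose_smul, star_trivial,
        h.conjTranspose_eq, hNh, add_left_inj]
    rw [mem_regularPart_iff, mem_zeroSetTangent_iff h.squareTraceless_ne, hXh, ← hN, hNX, hAX, h1X]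
    constructor
    · intro hx
      exact ⟨hx.conjTranspose_eq, hx.reTrace_eq, by rw [hx.norm_eq]; norm_num,
        by rw [hx.reTrace_cube, mul_zero]⟩
    · rintro ⟨a, b, c, d⟩
      refine ⟨a, b, ?_, (mul_eq_zero.1 d).resolve_left (pow_ne_zero _ hr), hX⟩
      have : ‖X‖ ^ 2 = 1 := by linarith
      exact (pow_eq_one_iff_of_nonneg (norm_nonneg _) two_ne_zero).1 this

end IsRegularZero

end Submanifold

/-! ### Differentiated constraints -/

section Constraints

variable {d : ℕ} {E : Type*} [NormedAddCommGroup E] [InnerProductSpace ℝ E]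
  {φ : (Fin d → ℝ) → E} {U : Set (Fin d → ℝ)}

theorem coordDeriv_mem_ker {G : Type*} [NormedAddCommGroup G] [NormedSpace ℝ G] (hU : IsOpen U)
    (hφ : ContDiffOn ℝ ∞ φ U) (K : E →L[ℝ] G) (hK : ∀ v ∈ U, K (φ v) = 0) (j : Fin d) :
    ∀ v ∈ U, K (coordDeriv j φ v) = 0 := fun v hv => by
  rw [← coordDeriv_clm_comp K (hφ.differentiableAt_of_isOpen hU hv),
    coordDeriv_congr_of_isOpen hU hK hv, coordDeriv_const]

theorem inner_coordDeriv_of_norm_eq_one (hU : IsOpen U) (hφ : ContDiffOn ℝ ∞ φ U)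
    (h1 : ∀ v ∈ U, ‖φ v‖ = 1) (j : Fin d) : ∀ v ∈ U, (inner ℝ (φ v) (coordDeriv j φ v) : ℝ) = 0 :=
  fun v hv => by
  have hd := hφ.differentiableAt_of_isOpen hU hv
  have h := coordDeriv_congr_of_isOpen (i := j) hU (f := fun v => (inner ℝ (φ v) (φ v) : ℝ))
    (g := fun _ => 1) (fun v hv => by rw [real_inner_self_eq_norm_sq, h1 v hv, one_pow]) hv
  rw [coordDeriv_inner hd hd, coordDeriv_const, real_inner_comm (φ v)] at h
  linarith

theorem inner_coordDeriv_coordDeriv_of_norm_eq_one (hU : IsOpen U) (hφ : ContDiffOn ℝ ∞ φ U)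
    (h1 : ∀ v ∈ U, ‖φ v‖ = 1) {u : Fin d → ℝ} (hu : u ∈ U) (i j : Fin d) :
    (inner ℝ (φ u) (coordDeriv i (coordDeriv j φ) u) : ℝ) =
      -inner ℝ (coordDeriv i φ u) (coordDeriv j φ u) := by
  have h := coordDeriv_congr_of_isOpen (i := i) hU
    (inner_coordDeriv_of_norm_eq_one hU hφ h1 j) hu
  rw [coordDeriv_inner (hφ.differentiableAt_of_isOpen hU hu)
    ((hφ.coordDeriv hU j).differentiableAt_of_isOpen hU hu), coordDeriv_const] at h
  linarith

theorem inner_coordDeriv_of_cubic (hU : IsOpen U) (hφ : ContDiffOn ℝ ∞ φ U)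
    (B : E →L[ℝ] E →L[ℝ] E) {f : E → ℝ} (hf : ∀ v ∈ U, f (φ v) = 0)
    (hf' : ∀ v ∈ U, HasFDerivAt f ((3 : ℝ) • innerSL ℝ (B (φ v) (φ v))) (φ v)) (j : Fin d) :
    ∀ v ∈ U, (inner ℝ (B (φ v) (φ v)) (coordDeriv j φ v) : ℝ) = 0 := fun v hv => by
  have h := coordDeriv_congr_of_isOpen (i := j) hU hf hv
  have h2 := ((hf' v hv).comp v (hφ.differentiableAt_of_isOpen hU hv).hasFDerivAt).fderiv
  rw [coordDeriv_const, coordDeriv, show (fun v => f (φ v)) = f ∘ φ from rfl, h2] at h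
  simpa [coordDeriv] using h

/-- Differentiating the tangency relation `⟨B(φ, φ), ∂ⱼφ⟩ = 0` once more determines the component of
`∂ᵢ∂ⱼφ` along `B(φ, φ)` by first derivatives alone. -/
theorem inner_coordDeriv_coordDeriv_of_cubic (hU : IsOpen U) (hφ : ContDiffOn ℝ ∞ φ U)
    (B : E →L[ℝ] E →L[ℝ] E) {f : E → ℝ} (hf : ∀ v ∈ U, f (φ v) = 0)
    (hf' : ∀ v ∈ U, HasFDerivAt f ((3 : ℝ) • innerSL ℝ (B (φ v) (φ v))) (φ v))
    {u : Fin d → ℝ} (hu : u ∈ U) (i j : Fin d) :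
    (inner ℝ (B (φ u) (φ u)) (coordDeriv i (coordDeriv j φ) u) : ℝ) =
      -inner ℝ (B (φ u) (coordDeriv i φ u) + B (coordDeriv i φ u) (φ u)) (coordDeriv j φ u) := by
  have hd := hφ.differentiableAt_of_isOpen hU hu
  have h := coordDeriv_congr_of_isOpen (i := i) hU
    (inner_coordDeriv_of_cubic hU hφ B hf hf' j) hu
  have hB : DifferentiableAt ℝ (fun v => B (φ v) (φ v)) u :=
    (B.hasFDerivAt_of_bilinear hd.hasFDerivAt hd.hasFDerivAt).differentiableAt
  rw [coordDeriv_inner hB ((hφ.coordDeriv hU j).differentiableAt_of_isOpen hU hu),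
    coordDeriv_const, coordDeriv_bilinear B hd hd] at h
  linarith

end Constraints

/-! ### The scalar curvature of the regular part -/

section Curvature

variable {F : Type*} [NormedRing F] [StarRing F] [InnerProductSpace ℝ F]
  [hF : IsQuaternionSubalgebra F]

/-- Of the three normal directions, `1` drops out because its constraint is linear, `A` gives the
curvature of the unit sphere, and `N` gives the term `|N|⁻² b ⊗ b`. The traces of `b` and `b²` are
then known. -/
theorem metricScalarCurvature_regularPart {d : ℕ} (hdim : d = 6 * Module.finrank ℝ F + 1)
    {U : Set (Fin d → ℝ)} {φ : (Fin d → ℝ) → Matrix (Fin 4) (Fin 4) F}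
    (hφ : IsLocalParametrization (regularPart 4 F) U φ) {u : Fin d → ℝ} (hu : u ∈ U) :
    metricScalarCurvature (firstFundamentalForm φ) u =
      6 * Module.finrank ℝ F * (6 * Module.finrank ℝ F + 1) -
        2 * Module.finrank ℝ F * (reTrace (φ u ^ 4) - 1 / 4)⁻¹ := by
  have hU := hφ.isOpen_source
  have hsm := hφ.contDiffOn
  have hreg : ∀ v ∈ U, IsRegularZero (φ v) := fun v hv => by
    obtain ⟨V, -, hV⟩ := hφ.image_eq
    have : φ v ∈ regularPart 4 F ∩ V := hV ▸ Set.mem_image_of_mem φ hv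
    exact mem_regularPart_iff.1 this.1
  have hA := hreg u hu
  set A := φ u with hAdef
  have hN := hA.norm_squareTraceless_ne
  have herm : ∀ v ∈ U, hermitianDefectCLM F 4 (φ v) = 0 := fun v hv =>
    (hermitianDefectCLM_eq_zero_iff _).2 (hreg v hv).conjTranspose_eq
  have herm1 := fun j => coordDeriv_mem_ker hU hsm (hermitianDefectCLM F 4) herm j
  have hv_herm : ∀ j, (coordDeriv j φ u)ᴴ = coordDeriv j φ u := fun j =>
    (hermitianDefectCLM_eq_zero_iff _).1 (herm1 j u hu)
  have hvv_herm : ∀ i j, (coordDeriv i (coordDeriv j φ) u)ᴴ = coordDeriv i (coordDeriv j φ) u :=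
    fun i j => (hermitianDefectCLM_eq_zero_iff _).1
      (coordDeriv_mem_ker hU (hsm.coordDeriv hU j) (hermitianDefectCLM F 4) (herm1 j) i u hu)
  have htr : ∀ v ∈ U, innerSL ℝ (1 : Matrix (Fin 4) (Fin 4) F) (φ v) = 0 := fun v hv =>
    (hreg v hv).inner_one_self
  have htr1 := fun j => coordDeriv_mem_ker hU hsm _ htr j
  have htr2 : ∀ i j, (inner ℝ 1 (coordDeriv i (coordDeriv j φ) u) : ℝ) = 0 := fun i j =>
    coordDeriv_mem_ker hU (hsm.coordDeriv hU j) _ (htr1 j) i u hu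
  have hnorm : ∀ v ∈ U, ‖φ v‖ = 1 := fun v hv => (hreg v hv).norm_eq
  have hn1 := fun j => inner_coordDeriv_of_norm_eq_one hU hsm hnorm j u hu
  have hn2 := inner_coordDeriv_coordDeriv_of_norm_eq_one hU hsm hnorm hu
  have hcube : ∀ v ∈ U, reTrace (φ v * φ v * φ v) = 0 := fun v hv => (hreg v hv).reTrace_cube
  have hcube' := fun v hv => hasFDerivAt_reTrace_cube (hreg v hv).conjTranspose_eq
  have hc1 : ∀ j, (inner ℝ (A * A) (coordDeriv j φ u) : ℝ) = 0 := fun j =>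
    inner_coordDeriv_of_cubic hU hsm (matrixMulCLM F 4)
      (f := fun X => reTrace (X * X * X)) hcube hcube' j u hu
  have hc2 : ∀ i j, (inner ℝ (A * A) (coordDeriv i (coordDeriv j φ) u) : ℝ) =
      -inner ℝ (anticommutator A (coordDeriv i φ u)) (coordDeriv j φ u) := fun i j => by
    rw [anticommutator_apply]
    exact inner_coordDeriv_coordDeriv_of_cubic hU hsm (matrixMulCLM F 4)
      (f := fun X => reTrace (X * X * X)) hcube hcube' hu i j
  have hvT : ∀ j, coordDeriv j φ u ∈ zeroSetTangent A := fun j => by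
    rw [mem_zeroSetTangent_iff hA.squareTraceless_ne]
    have h1 : (inner ℝ 1 (coordDeriv j φ u) : ℝ) = 0 := htr1 j u hu
    refine ⟨hv_herm j, h1, hn1 j, ?_⟩
    rw [IsRegularZero.inner_squareTraceless, hc1, h1]
    ring
  have hli := linearIndependent_coordDeriv (hφ.immersion u hu)
  -- The `6m + 1` independent coordinate vectors lie in a space of the same dimension.
  have hspan : Submodule.span ℝ (Set.range fun j => coordDeriv j φ u) = zeroSetTangent A := by
    refine Submodule.eq_of_le_of_finrank_eq (Submodule.span_le.2 ?_) ?_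
    · rintro _ ⟨j, rfl⟩
      exact hvT j
    · rw [finrank_span_eq_card hli, hA.finrank_zeroSetTangent, Fintype.card_fin, hdim]
  have hdet := (Matrix.isUnit_iff_isUnit_det _).1
    (isUnit_firstFundamentalForm (hφ.immersion u hu))
  have hG : ∀ i j, ∑ l, (firstFundamentalForm φ u)⁻¹ i l *
      inner ℝ (coordDeriv l φ u) (coordDeriv j φ u) = (if i = j then 1 else 0 : ℝ) := fun i j => by
    have h := congrFun (congrFun (Matrix.nonsing_inv_mul _ hdet) i) j
    rw [Matrix.mul_apply, Matrix.one_apply] at h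
    exact h
  have hQ := sum_gram_inv_smul (fun j => coordDeriv j φ u) _ hG
    (IsRegularZero.inner_tangentProjection (A := A))
    (fun j => tangentProjection_of_mem (hvT j)) (fun X => hspan ▸ hA.tangentProjection_mem X)
  -- The Christoffel sum is the tangential projection of `∂ⱼ∂ₖφ`. This vector is Hermitian, so what
  -- remains is its expansion in the three normal vectors.
  have hII : ∀ j k, secondFundamentalForm φ j k u =
      ∑ a, (inner ℝ (normalVectors A a) (coordDeriv j (coordDeriv k φ) u) : ℝ) •
        normalVectors A a := fun j k => by
    have h1 : ∑ m, christoffel (firstFundamentalForm φ) m j k u • coordDeriv m φ u =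
        tangentProjection A (coordDeriv j (coordDeriv k φ) u) := by
      rw [← hQ]
      refine Finset.sum_congr rfl fun m _ => ?_
      rw [christoffel_firstFundamentalForm hU hsm hu, Finset.sum_smul]
      exact Finset.sum_congr rfl fun l _ => by rw [real_inner_comm]
    rw [secondFundamentalForm, h1, tangentProjection, removeDirections_apply,
      hermitianPart_of_isHermitian (hvv_herm j k)]
    abel
  have hNvv : ∀ i j, (inner ℝ (squareTraceless A) (coordDeriv i (coordDeriv j φ) u) : ℝ) =
      -inner ℝ (anticommutator A (coordDeriv i φ u)) (coordDeriv j φ u) := fun i j => by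
    rw [IsRegularZero.inner_squareTraceless, hc2, htr2]
    ring
  have hgauss : ∀ i j k l, (inner ℝ (coordDeriv i (coordDeriv l φ) u)
      (secondFundamentalForm φ j k u) : ℝ) =
      firstFundamentalForm φ u i l * firstFundamentalForm φ u j k +
        (‖squareTraceless A‖ ^ 2)⁻¹ *
          (inner ℝ (coordDeriv l φ u) (anticommutator A (coordDeriv i φ u)) *
            inner ℝ (coordDeriv k φ u) (anticommutator A (coordDeriv j φ u))) := by
    intro i j k l
    have e0 : ∀ i l, (inner ℝ (normalVectors A 0) (coordDeriv i (coordDeriv l φ) u) : ℝ) = 0 :=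
      fun i l => by
        change (inner ℝ ((1 / 2 : ℝ) • (1 : Matrix (Fin 4) (Fin 4) F)) _ : ℝ) = 0
        rw [real_inner_smul_left, htr2, mul_zero]
    have e1 : ∀ i l, (inner ℝ (normalVectors A 1) (coordDeriv i (coordDeriv l φ) u) : ℝ) =
        -firstFundamentalForm φ u i l := fun i l => hn2 i l
    have e2 : ∀ i l, (inner ℝ (normalVectors A 2) (coordDeriv i (coordDeriv l φ) u) : ℝ) =
        -(‖squareTraceless A‖⁻¹ *
          inner ℝ (coordDeriv l φ u) (anticommutator A (coordDeriv i φ u))) := fun i l => by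
      change (inner ℝ (‖squareTraceless A‖⁻¹ • squareTraceless A) _ : ℝ) = _
      rw [real_inner_smul_left, hNvv, real_inner_comm]
      ring
    rw [hII, inner_sum]
    simp only [real_inner_smul_right, Fin.sum_univ_three, e0, e1, e2,
      real_inner_comm (normalVectors A _)]
    field_simp
    ring
  rw [metricScalarCurvature_eq hU hsm hφ.immersion hu
    (fun i j => inner ℝ (coordDeriv j φ u) (anticommutator A (coordDeriv i φ u))) _ hgauss,
    sum_gram_inv_mul_inner _ _ hQ, tangentProjection, hA.trace_anticommutator_removeDirections]
  -- One inverse Gram matrix is absorbed in the trace formula, the other is the expansion of the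
  -- inner tangent projection.
  have hsq : ∑ j, ∑ k, ∑ i, ∑ l, (firstFundamentalForm φ u)⁻¹ j k *
      (firstFundamentalForm φ u)⁻¹ i l *
        ((inner ℝ (coordDeriv l φ u) (anticommutator A (coordDeriv j φ u)) : ℝ) *
          inner ℝ (coordDeriv k φ u) (anticommutator A (coordDeriv i φ u))) =
      2 * Module.finrank ℝ F := by
    rw [← hA.trace_anticommutator_removeDirections_sq, ← tangentProjection]
    refine Eq.trans ?_ (sum_gram_inv_mul_inner _ _ hQ
      (anticommutator A ∘ₗ tangentProjection A ∘ₗ anticommutator A))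
    refine Finset.sum_congr rfl fun j _ => Finset.sum_congr rfl fun k _ => ?_
    simp only [LinearMap.comp_apply, ← hQ, map_sum, map_smul, inner_sum, inner_smul_right,
      Finset.mul_sum]
    exact Finset.sum_congr rfl fun i _ => Finset.sum_congr rfl fun l _ => by ring
  rw [hsq, hA.norm_squareTraceless_sq, hdim]
  push_cast
  ring

end Curvature

/-! ### Limits of the scalar curvature and the three algebras -/

section Main

variable {F : Type*} [NormedRing F] [StarRing F] [InnerProductSpace ℝ F]
  [hF : IsQuaternionSubalgebra F]

theorem continuous_tracePow_four : Continuous (tracePow 4 : Matrix (Fin 4) (Fin 4) F → ℝ) := by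
  have h : (tracePow 4 : Matrix (Fin 4) (Fin 4) F → ℝ) =
      fun A => inner ℝ 1 ((A * A) * (A * A)) := by
    funext A
    rw [tracePow_eq_reTrace, reTrace_eq_inner]
    simp only [pow_succ, pow_zero, one_mul, mul_assoc]
  have hc := (contDiff_mul_self (F := F) (n := 4)).continuous
  rw [h]
  exact continuous_const.inner (hc.comp hc)

/-- At a critical point `A² = 1/4`, so `A⁴ = 1/16`, with trace `4/16`. -/
theorem tracePow_four_of_mem_singularPart {A : Matrix (Fin 4) (Fin 4) F}
    (hA : A ∈ singularPart 4 F) : tracePow 4 A = 1 / 4 := by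
  obtain ⟨h1, h2⟩ := hA
  rw [isRegularPoint_iff h1, not_not, squareTraceless, sub_eq_zero] at h2
  have h4 : A ^ 4 = (1 / 16 : ℝ) • (1 : Matrix (Fin 4) (Fin 4) F) := by
    rw [show A ^ 4 = (A * A) * (A * A) by simp only [pow_succ, pow_zero, one_mul, mul_assoc], h2,
      smul_mul_smul_comm, one_mul]
    norm_num
  rw [tracePow_eq_reTrace, h4, reTrace_smul, reTrace_one]
  norm_num

/-- The scalar curvature of the regular part, over any of the three algebras. -/
theorem exists_scalarCurvature (F : Type*) [NormedRing F] [StarRing F] [InnerProductSpace ℝ F]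
    [IsQuaternionSubalgebra F] {m : ℕ} (hm : Module.finrank ℝ F = m) :
    ∃ s : Matrix (Fin 4) (Fin 4) F → ℝ,
      (∀ A ∈ regularPart 4 F,
        HasScalarCurvatureAt (regularPart 4 F) (6 * m + 1) A (s A) ∧
        s A = 6 * m * (6 * m + 1) - 2 * m * (tracePow 4 A - 1 / 4)⁻¹) ∧
      Tendsto s (comap (tracePow 4) (𝓝 (1 / 4)) ⊓ 𝓟 (regularPart 4 F)) atBot ∧
      Tendsto s (𝓝ˢ (singularPart 4 F) ⊓ 𝓟 (regularPart 4 F)) atBot := by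
  have hlim : Tendsto
      (fun A => (6 * m * (6 * m + 1) - 2 * m * (tracePow 4 A - 1 / 4)⁻¹ : ℝ))
      (comap (tracePow 4) (𝓝 (1 / 4)) ⊓ 𝓟 (regularPart 4 F)) atBot := by
    have hnt : Nontrivial F := (quaternionEmbedding F).domain_nontrivial
    have hmpos : (0 : ℝ) < m := by
      rw [← hm]
      exact_mod_cast Module.finrank_pos
    have h1 : Tendsto (fun A : Matrix (Fin 4) (Fin 4) F => tracePow 4 A - 1 / 4)
        (comap (tracePow 4) (𝓝 (1 / 4)) ⊓ 𝓟 (regularPart 4 F)) (𝓝[>] 0) := by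
      refine tendsto_nhdsWithin_iff.2 ⟨?_, ?_⟩
      · have : Tendsto (fun A : Matrix (Fin 4) (Fin 4) F => tracePow 4 A - 1 / 4)
            (comap (tracePow 4) (𝓝 (1 / 4))) (𝓝 (1 / 4 - 1 / 4)) :=
          tendsto_comap.sub_const _
        rw [sub_self] at this
        exact this.mono_left inf_le_left
      · filter_upwards [mem_inf_of_right (mem_principal_self _)] with A hA
        have h := mem_regularPart_iff.1 hA
        rw [tracePow_eq_reTrace, ← h.norm_squareTraceless_sq]
        exact pow_pos (norm_pos_iff.2 h.squareTraceless_ne) 2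
    have h2 := (tendsto_inv_nhdsGT_zero.comp h1).const_mul_atTop (show (0 : ℝ) < 2 * m by positivity)
    exact tendsto_atBot_add_const_left _ _ (tendsto_neg_atTop_atBot.comp h2)
  refine ⟨_, fun A hA => ⟨⟨?_, ?_⟩, rfl⟩, hlim, hlim.mono_left (inf_le_inf_right _ ?_)⟩
  · subst hm
    exact (mem_regularPart_iff.1 hA).exists_isLocalParametrization_regularPart
  · rintro U φ hφ u hu rfl
    rw [metricScalarCurvature_regularPart (by rw [hm]) hφ hu, hm]
    rfl
  -- By continuity of `tr A⁴`, approaching a critical point forces `tr A⁴ → 1/4`; the second limit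
  -- is thus a case of the first.
  · rw [nhdsSet, sSup_le_iff]
    rintro _ ⟨A, hA, rfl⟩
    rw [← tracePow_four_of_mem_singularPart hA]
    exact continuous_tracePow_four.continuousAt.tendsto.le_comap

end Main

end

theorem mainTheorem8 :
    (∃ s : Matrix (Fin 4) (Fin 4) ℝ → ℝ,
      (∀ A ∈ regularPart 4 ℝ,
        HasScalarCurvatureAt (regularPart 4 ℝ) (6 * 1 + 1) A (s A) ∧
        s A = 6 * 1 * (6 * 1 + 1) - 2 * 1 * (tracePow 4 A - 1 / 4)⁻¹) ∧
      Tendsto s (comap (tracePow 4) (𝓝 (1 / 4)) ⊓ 𝓟 (regularPart 4 ℝ)) atBot ∧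
      Tendsto s (𝓝ˢ (singularPart 4 ℝ) ⊓ 𝓟 (regularPart 4 ℝ)) atBot) ∧
    (∃ s : Matrix (Fin 4) (Fin 4) ℂ → ℝ,
      (∀ A ∈ regularPart 4 ℂ,
        HasScalarCurvatureAt (regularPart 4 ℂ) (6 * 2 + 1) A (s A) ∧
        s A = 6 * 2 * (6 * 2 + 1) - 2 * 2 * (tracePow 4 A - 1 / 4)⁻¹) ∧
      Tendsto s (comap (tracePow 4) (𝓝 (1 / 4)) ⊓ 𝓟 (regularPart 4 ℂ)) atBot ∧
      Tendsto s (𝓝ˢ (singularPart 4 ℂ) ⊓ 𝓟 (regularPart 4 ℂ)) atBot) ∧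
    (∃ s : Matrix (Fin 4) (Fin 4) ℍ[ℝ] → ℝ,
      (∀ A ∈ regularPart 4 ℍ[ℝ],
        HasScalarCurvatureAt (regularPart 4 ℍ[ℝ]) (6 * 4 + 1) A (s A) ∧
        s A = 6 * 4 * (6 * 4 + 1) - 2 * 4 * (tracePow 4 A - 1 / 4)⁻¹) ∧
      Tendsto s (comap (tracePow 4) (𝓝 (1 / 4)) ⊓ 𝓟 (regularPart 4 ℍ[ℝ])) atBot ∧
      Tendsto s (𝓝ˢ (singularPart 4 ℍ[ℝ]) ⊓ 𝓟 (regularPart 4 ℍ[ℝ])) atBot) := by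
  refine ⟨?_, ?_, ?_⟩
  · simpa only [Nat.cast_one] using exists_scalarCurvature ℝ (Module.finrank_self ℝ)
  · simpa only [Nat.cast_ofNat] using exists_scalarCurvature ℂ Complex.finrank_real_complex
  · simpa only [Nat.cast_ofNat] using exists_scalarCurvature ℍ[ℝ] Quaternion.finrank_eq_four
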